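/- Let $k$ be one of the fields $\mathbb{R}$, $\mathbb{Q}_p$ ($p$ prime), or a finite extension of one of these, with its usual absolute value. Let $K=k((h))$, and let $K^*=k(\{h\})\subset K$ be the field of convergent Laurent series, i.e. of those $f\in K$ such that $h^rf$ is, for some integer $r$, a power series with non-zero radius of convergence. Let $\varepsilon$ be the automorphism $f(h)\mapsto f(-h)$ of $K$. "Congruent modulo $h^m$" means that the difference lies in $h^m k[[h]]$. For an $\varepsilon$-invariant subfield $L$ of $K$ put $U_N^\varepsilon(L)=\{x\in GL_N(L)\mid x^{-1}={}^t\varepsilon(x)\}$. (1) Let $L$ be a subfield of $K$ that contains $k(h)$ and is finitely generated over $k$. For any $a_1,\dots,a_t\in L$ and any $m\ge 0$ there are a subfield $L^*$ of $K^*$ containing $k(h)$ and a field isomorphism $L\to L^*$ that is the identity on $k(h)$, such that each $a_i$ is congruent to its image modulo $h^m$. (2) If moreover $L$ is $\varepsilon$-invariant, then, for any $a_1,\dots,a_t\in L$ and any $m\ge 0$, there are an $\varepsilon$-invariant subfield $L^*$ of $K^*$ containing $k(h)$ and a field isomorphism $\Omega:L\to L^*$ that is the identity on $k(h)$ and satisfies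 $\varepsilon\circ\Omega=\Omega\circ\varepsilon$, such that each $a_i$ is congruent to $\Omega(a_i)$ modulo $h^m$. (3) Let $k=\mathbb{R}$, let $G$ be a finitely generated group, and let $R:G\to U_N^\varepsilon(\mathbb{R}((h)))$ be a homomorphism. There is a smallest $\varepsilon$-invariant subfield of $\mathbb{R}((h))$ that contains $\mathbb{R}(h)$ and all the matrix coefficients of the $R(g)$, $g\in G$, and it is finitely generated over $\mathbb{R}$ (so that (2) applies to it). Let $L$ be any $\varepsilon$-invariant subfield of $\mathbb{R}((h))$ that contains $\mathbb{R}(h)$ and these coefficients, and let $\Omega:L\to L^*$ be any field isomorphism with $\varepsilon\circ\Omega=\Omega\circ\varepsilon$ onto an $\varepsilon$-invariant subfield $L^*$ of $\mathbb{R}(\{h\})$ containing $\mathbb{R}(h)$. Then $\Omega$, applied to the coefficients, maps $U_N^\varepsilon(L)$ onto $U_N^\varepsilon(L^*)$, and $R^*=\Omega\circ R$ is a homomorphism $G\to U_N^\varepsilon(\mathbb{R}(\{h\}))$. With $c:\mathbb{R}((h))\to\mathbb{C}((h))$, $f(h)\mapsto f(\mathrm{i}h)$, and $\eta$ the complex conjugation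 of the coefficients on $\mathbb{C}((h))$, the matrices $c(R^*(g))$ have convergent coefficients and satisfy $x^{-1}={}^t\eta(x)$. There is a $\delta>0$ such that, for every real $s$ with $0<|s|<\delta$, all coefficients of all the matrices $c(R^*(g))$, $g\in G$, converge at $h=s$, and $g\mapsto c(R^*(g))|_{h=s}$ is a homomorphism from $G$ to the ordinary unitary group $U_N\subset GL_N(\mathbb{C})$. -/

import Mathlib

open scoped LaurentSeries

noncomputable section

namespace FormalUnitarity

/-- `k` is one of the fields `ℝ`, `ℚ_p`, or a finite extension of one of them, with the absolute
value that extends the usual one. -/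
def IsRealOrPadicField (k : Type*) [NormedField k] : Prop :=
  (∃ _ : NormedAlgebra ℝ k, FiniteDimensional ℝ k) ∨
    ∃ (p : ℕ) (_ : Fact p.Prime) (_ : NormedAlgebra ℚ_[p] k), FiniteDimensional ℚ_[p] k

/-- A power series is convergent if its radius of convergence is nonzero. -/
def IsConvergentPowerSeries {k : Type*} [NontriviallyNormedField k] (f : PowerSeries k) : Prop :=
  0 < (FormalMultilinearSeries.ofScalars k (fun n : ℕ => PowerSeries.coeff n f)).radius

/-- A Laurent series `f` is convergent if `h ^ r * f` is a convergent power series for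
some integer `r`. -/
def IsConvergent {k : Type*} [NontriviallyNormedField k] (f : k⸨X⸩) : Prop :=
  ∃ (r : ℤ) (g : PowerSeries k), IsConvergentPowerSeries g ∧
    HahnSeries.single r 1 * f = HahnSeries.ofPowerSeries ℤ k g

/-- Congruence of Laurent series modulo `h ^ m`, i.e. modulo `h ^ m k[[h]]`. -/
def CongrMod {k : Type*} [Field k] (m : ℕ) (f g : k⸨X⸩) : Prop :=
  ∃ q : PowerSeries k, f - g = HahnSeries.single (m : ℤ) 1 * HahnSeries.ofPowerSeries ℤ k q

section Substitution

variable {k k' : Type*} [Field k] [Field k']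

theorem support_twist_subset (σ : k →+* k') (u : k'ˣ) (f : k⸨X⸩) :
    (Function.support fun n : ℤ => σ (f.coeff n) * ((u ^ n : k'ˣ) : k')) ⊆ f.support := by
  intro n hn h0
  apply hn
  simp only [h0, map_zero, zero_mul]

/-- The underlying map of the substitution `∑ aₙ hⁿ ↦ ∑ σ(aₙ) uⁿ hⁿ`. -/
def twistFun (σ : k →+* k') (u : k'ˣ) (f : k⸨X⸩) : k'⸨X⸩ where
  coeff n := σ (f.coeff n) * ((u ^ n : k'ˣ) : k')
  isPWO_support' := f.isPWO_support.mono (support_twist_subset σ u f)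

/-- The substitution `∑ aₙ hⁿ ↦ ∑ σ(aₙ) uⁿ hⁿ`: apply `σ` to the coefficients, then
replace `h` by `u h`. -/
def twist (σ : k →+* k') (u : k'ˣ) : k⸨X⸩ →+* k'⸨X⸩ where
  toFun := twistFun σ u
  map_zero' := by ext n; simp [twistFun]
  map_one' := by
    ext n
    by_cases hn : n = 0 <;> simp [twistFun, HahnSeries.coeff_one, hn]
  map_add' f g := by ext n; simp [twistFun, add_mul]
  map_mul' f g := by
    have hf : (twistFun σ u f).support ⊆ f.support := support_twist_subset σ u f
    have hg : (twistFun σ u g).support ⊆ g.support := support_twist_subset σ u g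
    ext n
    calc (twistFun σ u (f * g)).coeff n
        = σ ((f * g).coeff n) * ((u ^ n : k'ˣ) : k') := rfl
      _ = ∑ ij ∈ Finset.antidiagonal f.isPWO_support g.isPWO_support n,
            (twistFun σ u f).coeff ij.1 * (twistFun σ u g).coeff ij.2 := ?_
      _ = (twistFun σ u f * twistFun σ u g).coeff n := ?_
    · rw [HahnSeries.coeff_mul, map_sum, Finset.sum_mul]
      refine Finset.sum_congr rfl fun ij hij => ?_
      have h : ij.1 + ij.2 = n := (Finset.mem_antidiagonal.mp hij).2.2
      simp only [twistFun, map_mul]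
      rw [← h, zpow_add, Units.val_mul]
      ring
    · rw [HahnSeries.coeff_mul]
      refine (Finset.sum_subset ?_ ?_).symm
      · intro ij hij
        obtain ⟨h1, h2, h3⟩ := Finset.mem_antidiagonal.mp hij
        exact Finset.mem_antidiagonal.mpr ⟨hf h1, hg h2, h3⟩
      · intro ij hij hn
        by_contra h0
        exact hn (Finset.mem_antidiagonal.mpr ⟨left_ne_zero_of_mul h0,
          right_ne_zero_of_mul h0, (Finset.mem_antidiagonal.mp hij).2.2⟩)

end Substitution

/-- The automorphism `ε : f(h) ↦ f(-h)` of `k((h))`. -/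
def eps (k : Type*) [Field k] : k⸨X⸩ →+* k⸨X⸩ := twist (RingHom.id k) (-1)

/-- The rescaling `c : f(h) ↦ f(i h)`, from `ℝ((h))` to `ℂ((h))`. -/
def rescaleI : ℝ⸨X⸩ →+* ℂ⸨X⸩ :=
  twist Complex.ofRealHom (Units.mk0 Complex.I Complex.I_ne_zero)

/-- The automorphism `η` of `ℂ((h))`: complex conjugation of the coefficients. -/
def eta : ℂ⸨X⸩ →+* ℂ⸨X⸩ := twist (starRingEnd ℂ) 1

/-- The subfield `k(h)` of `k((h))`; the variable `h` is the Laurent series `single 1 1`. -/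
def rationalFunctions (k : Type*) [Field k] : IntermediateField k k⸨X⸩ :=
  IntermediateField.adjoin k {HahnSeries.single 1 1}

/-- A subfield `L` of `k((h))` is `ε`-invariant. -/
def EpsInvariant {k : Type*} [Field k] (L : IntermediateField k k⸨X⸩) : Prop :=
  ∀ x ∈ L, eps k x ∈ L

/-- The field `L` lies in the field `k({h})` of convergent Laurent series. -/
def IsConvergentSubfield {k : Type*} [NontriviallyNormedField k]
    (L : IntermediateField k k⸨X⸩) : Prop :=
  ∀ x ∈ L, IsConvergent x

/-- The field isomorphism `φ : L ≃ L'` is an isomorphism over `k(h)`: it is the identity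
on `k(h)`. -/
def IsOverRationalFunctions {k : Type*} [Field k] {L L' : IntermediateField k k⸨X⸩}
    (φ : L ≃+* L') : Prop :=
  ∀ x : L, (x : k⸨X⸩) ∈ rationalFunctions k → (φ x : k⸨X⸩) = x

/-- The field isomorphism `Ω : L ≃ L'` satisfies `ε ∘ Ω = Ω ∘ ε`, for an `ε`-invariant `L`. -/
def IsEpsEquivariant {k : Type*} [Field k] {L L' : IntermediateField k k⸨X⸩}
    (hL : EpsInvariant L) (Ω : L ≃+* L') : Prop :=
  ∀ x : L, eps k (Ω x : k⸨X⸩) = (Ω ⟨eps k (x : k⸨X⸩), hL x x.2⟩ : k⸨X⸩)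

/-- The group `{x ∈ GL_N(F) | x⁻¹ = ᵗσ(x)}`, for an endomorphism `σ` of a field `F`. -/
def unitarySubgroup {F : Type*} [Field F] (N : ℕ) (σ : F →+* F) :
    Subgroup (Matrix.GeneralLinearGroup (Fin N) F) where
  carrier := {x | (x⁻¹).val = (x.val.map σ).transpose}
  one_mem' := by simp
  mul_mem' := by
    intro x y hx hy
    simp only [Set.mem_ofPred_eq] at hx hy ⊢
    rw [mul_inv_rev, Units.val_mul, Units.val_mul, hx, hy, Matrix.map_mul, Matrix.transpose_mul]
  inv_mem' := by
    intro x hx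
    simp only [Set.mem_ofPred_eq] at hx ⊢
    have h1 : (x⁻¹).val.map σ * x.val.map σ = 1 := by
      rw [← Matrix.map_mul, Units.inv_mul]; simp
    have h2 : x.val.map σ = (x⁻¹).val.transpose := by rw [hx, Matrix.transpose_transpose]
    rw [h2] at h1
    have h3 : x⁻¹.val * ((x⁻¹).val.map σ).transpose = 1 := by
      have := congrArg Matrix.transpose h1
      simpa [Matrix.transpose_mul] using this
    rw [inv_inv]
    calc x.val = x.val * (x⁻¹.val * ((x⁻¹).val.map σ).transpose) := by rw [h3, mul_one]
      _ = ((x⁻¹).val.map σ).transpose := by rw [← mul_assoc, Units.mul_inv, one_mul]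

/-- The group `U_N^ε(L) = {x ∈ GL_N(L) | x⁻¹ = ᵗε(x)}` of a subfield `L` of `k((h))`;
the equation is read in `GL_N(k((h)))`. -/
def unitaryOver {k : Type*} [Field k] (N : ℕ) (L : IntermediateField k k⸨X⸩) :
    Subgroup (Matrix.GeneralLinearGroup (Fin N) L) :=
  (unitarySubgroup N (eps k)).comap (Matrix.GeneralLinearGroup.map (algebraMap L k⸨X⸩))

end FormalUnitarity

end

/-! Give K the h-adic topology and maps F → K the topology of pointwise convergence. Behind (1) lies
the claim that, for F finitely generated over k and containing k(h), the inclusion F → K is a limit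
of k-embeddings that fix h and have convergent values (`HasConvergentModels`). One generator α is
added at a time (`HasConvergentModels.adjoin_simple`). An element of F(α) is a quotient r(α)/s(α),
which varies continuously with the embedding φ of F and the image β of α. So it suffices to find a
convergent β near α that satisfies the relations of α transported by φ, and no others. If α is
algebraic, its minimal polynomial is separable, and a Hensel argument gives a convergent root after
a small change of its coefficients (`exists_convergent_root_near`). Convergence comes from a
majorant estimate for y = h G(y) (`exists_convergent_fixedPoint`). If α is transcendental, β = a +
hⁿz, where a is a rational function near α and z is convergent and transcendental over a finitely
generated field containing h and φ(F). Such z exist because the convergent series have infinite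
transcendence degree over k (`exists_convergent_transcendental`).

For (2), write f = a(h²) + h b(h²). On pairs (a, b), ε is (a, b) ↦ (a, -b), and the multiplication
law involves only the entries and h. An embedding of the field of parts that fixes h therefore acts
on pairs by a ring homomorphism commuting with ε (`parityExtend`). The field of parts is again
finitely generated, so the approximation result for (1) applies to it.

For (3), unitarity expresses ε(R(g)ᵢⱼ) as an entry of R(g⁻¹), so the field of coefficients is
ε-stable, and finitely many g suffice to generate it. The substitution h ↦ ih turns ε on real series
into η, and η becomes complex conjugation after evaluation at a real point. Series absolutely
convergent at |s| form a ring on which evaluation is multiplicative, so δ has to be chosen for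
finitely many matrices only. -/

noncomputable section

namespace FormalUnitarity

open Filter Topology

/-! ### Absolute convergence of Laurent series at a given radius -/

section Summability

variable {k : Type*} [NormedField k]

/-- The Laurent series `f` converges absolutely at radius `r`. -/
def SummableAt (r : ℝ) (f : k⸨X⸩) : Prop := Summable fun n : ℤ => ‖f.coeff n‖ * r ^ n

/-- The finite sum over an antidiagonal becomes a sum over all of ℤ, with index set independent of
f, g and n. This is the form in which Cauchy products of summable families apply. -/
theorem hasSum_coeff_mul (f g : k⸨X⸩) (n : ℤ) :
    HasSum (fun i : ℤ => f.coeff i * g.coeff (n - i)) ((f * g).coeff n) := by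
  rw [HahnSeries.coeff_mul]
  let T := (Finset.antidiagonal f.isPWO_support g.isPWO_support n).image Prod.fst
  have hT : ∑ ij ∈ Finset.antidiagonal f.isPWO_support g.isPWO_support n,
      f.coeff ij.1 * g.coeff ij.2 = ∑ i ∈ T, f.coeff i * g.coeff (n - i) := by
    rw [Finset.sum_image]
    · refine Finset.sum_congr rfl fun ij hij => ?_
      have h := (Finset.mem_antidiagonal.mp hij).2.2
      rw [show ij.2 = n - ij.1 by omega]
    · intro a ha b hb hab
      have h1 := (Finset.mem_antidiagonal.mp ha).2.2
      have h2 := (Finset.mem_antidiagonal.mp hb).2.2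
      exact Prod.ext hab (by omega)
  rw [hT]
  refine hasSum_sum_of_ne_finset_zero fun i hi => ?_
  by_contra h0
  exact hi (Finset.mem_image.mpr ⟨(i, n - i), Finset.mem_antidiagonal.mpr
    ⟨left_ne_zero_of_mul h0, right_ne_zero_of_mul h0, by simp⟩, rfl⟩)

/-- The change of variables `(n, i) ↦ (i, n - i)` of `ℤ × ℤ`. -/
def convolutionEquiv : ℤ × ℤ ≃ ℤ × ℤ where
  toFun p := (p.2, p.1 - p.2)
  invFun p := (p.1 + p.2, p.1)
  left_inv p := by simp
  right_inv p := by simp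

theorem SummableAt.mul {r : ℝ} (hr : 0 < r) {f g : k⸨X⸩} (hf : SummableAt r f)
    (hg : SummableAt r g) : SummableAt r (f * g) := by
  have h := Summable.mul_of_nonneg hf hg (fun n => by positivity) (fun n => by positivity)
  have h' := (convolutionEquiv.summable_iff (f := fun x : ℤ × ℤ =>
    (‖f.coeff x.1‖ * r ^ x.1) * (‖g.coeff x.2‖ * r ^ x.2))).mpr h
  refine Summable.of_nonneg_of_le (fun n => by positivity) (fun n => ?_) h'.prod
  have h1 : (fun i : ℤ => ‖f.coeff i * g.coeff (n - i)‖ * r ^ n) = fun i =>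
      ((fun x : ℤ × ℤ => (‖f.coeff x.1‖ * r ^ x.1) * (‖g.coeff x.2‖ * r ^ x.2)) ∘
        convolutionEquiv) (n, i) := by
    funext i
    simp only [Function.comp, convolutionEquiv, Equiv.coe_fn_mk, norm_mul]
    rw [show n = i + (n - i) by ring, zpow_add₀ hr.ne']
    simp only [add_sub_cancel]
    ring
  rw [← h1, tsum_mul_right]
  gcongr
  rw [← (hasSum_coeff_mul f g n).tsum_eq]
  refine norm_tsum_le_tsum_norm ?_
  refine summable_of_hasFiniteSupport
    ((Finset.antidiagonal f.isPWO_support g.isPWO_support n).finite_toSet.image Prod.fst |>.subset ?_)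
  intro i hi
  have h0 : f.coeff i * g.coeff (n - i) ≠ 0 := by simpa using hi
  exact ⟨(i, n - i), Finset.mem_coe.mpr (Finset.mem_antidiagonal.mpr
    ⟨left_ne_zero_of_mul h0, right_ne_zero_of_mul h0, by simp⟩), rfl⟩

theorem SummableAt.add {r : ℝ} (hr : 0 < r) {f g : k⸨X⸩} (hf : SummableAt r f)
    (hg : SummableAt r g) : SummableAt r (f + g) := by
  refine Summable.of_nonneg_of_le (fun n => by positivity) (fun n => ?_) (Summable.add hf hg)
  rw [← add_mul]
  gcongr
  simpa using norm_add_le _ _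

theorem SummableAt.neg {r : ℝ} {f : k⸨X⸩} (hf : SummableAt r f) : SummableAt r (-f) := by
  simpa [SummableAt] using hf

theorem summableAt_single (r : ℝ) (m : ℤ) (c : k) :
    SummableAt r (HahnSeries.single m c : k⸨X⸩) := by
  refine summable_of_hasFiniteSupport ((Set.finite_singleton m).subset fun n hn => ?_)
  by_contra h
  exact hn (by simp [HahnSeries.coeff_single_of_ne h])

theorem summableAt_zero (r : ℝ) : SummableAt r (0 : k⸨X⸩) := by
  simp [SummableAt]

theorem summableAt_one (r : ℝ) : SummableAt r (1 : k⸨X⸩) := summableAt_single r 0 1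

theorem finite_neg_support (f : k⸨X⸩) : {n : ℤ | n < 0 ∧ f.coeff n ≠ 0}.Finite := by
  refine (Set.finite_Ico f.order 0).subset fun n hn => ⟨?_, hn.1⟩
  exact HahnSeries.order_le_of_coeff_ne_zero hn.2

/-- Terms of nonnegative exponent shrink with the radius. Those of negative exponent may grow, but
only finitely many are nonzero, so the comparison holds cofinitely. -/
theorem SummableAt.mono {r s : ℝ} (hs : 0 < s) (hsr : s ≤ r) {f : k⸨X⸩} (hf : SummableAt r f) :
    SummableAt s f := by
  refine Summable.of_norm_bounded_eventually hf ?_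
  refine (finite_neg_support f).subset fun n hn => ?_
  replace hn : ‖f.coeff n‖ * r ^ n < ‖‖f.coeff n‖ * s ^ n‖ := not_le.mp hn
  have hr : 0 < r := hs.trans_le hsr
  constructor
  · by_contra h0
    have : s ^ n ≤ r ^ n := zpow_le_zpow_left₀ (by omega) hs.le hsr
    refine absurd hn (not_lt.mpr ?_)
    rw [Real.norm_of_nonneg (by positivity)]
    gcongr
  · rintro h0
    simp [h0] at hn

theorem summableAt_ofPowerSeries {r : ℝ} {g : PowerSeries k} :
    SummableAt r (HahnSeries.ofPowerSeries ℤ k g) ↔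
      Summable fun n : ℕ => ‖PowerSeries.coeff n g‖ * r ^ n := by
  rw [SummableAt, ← (Nat.cast_injective (R := ℤ)).summable_iff]
  · simp [Function.comp_def]
  · intro n hn
    have : n < 0 := by
      by_contra h
      exact hn ⟨n.toNat, by simp; omega⟩
    simp [PowerSeries.coeff_coe, this]

end Summability

/-! ### The field of convergent series; majorants for fixed-point equations -/

section Convergent

variable {k : Type*} [NontriviallyNormedField k]

theorem isConvergentPowerSeries_iff {g : PowerSeries k} :
    IsConvergentPowerSeries g ↔
      ∃ r : ℝ, 0 < r ∧ SummableAt r (HahnSeries.ofPowerSeries ℤ k g) := by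
  simp only [summableAt_ofPowerSeries, IsConvergentPowerSeries]
  constructor
  · intro h
    obtain ⟨r, hr0, hr⟩ := ENNReal.lt_iff_exists_nnreal_btwn.mp h
    refine ⟨r, by exact_mod_cast hr0, ?_⟩
    have := FormalMultilinearSeries.summable_norm_mul_pow _ hr
    simpa [FormalMultilinearSeries.ofScalars_norm] using this
  · rintro ⟨r, hr0, hr⟩
    lift r to NNReal using hr0.le
    refine lt_of_lt_of_le (b := (r : ENNReal)) (by exact_mod_cast hr0) ?_
    refine FormalMultilinearSeries.le_radius_of_summable _ ?_
    simpa [FormalMultilinearSeries.ofScalars_norm] using hr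

theorem isConvergent_iff {f : k⸨X⸩} : IsConvergent f ↔ ∃ r : ℝ, 0 < r ∧ SummableAt r f := by
  constructor
  · rintro ⟨m, g, hg, hfg⟩
    obtain ⟨r, hr0, hr⟩ := isConvergentPowerSeries_iff.mp hg
    refine ⟨r, hr0, ?_⟩
    have : f = HahnSeries.single (-m) 1 * HahnSeries.ofPowerSeries ℤ k g := by
      rw [← hfg, ← mul_assoc, HahnSeries.single_mul_single]
      simp
    rw [this]
    exact (summableAt_single r _ _).mul hr0 hr
  · rintro ⟨r, hr0, hr⟩
    refine ⟨-f.order, f.powerSeriesPart, ?_, (LaurentSeries.ofPowerSeries_powerSeriesPart f).symm⟩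
    rw [isConvergentPowerSeries_iff]
    refine ⟨r, hr0, ?_⟩
    rw [LaurentSeries.ofPowerSeries_powerSeriesPart]
    exact (summableAt_single r _ _).mul hr0 hr

theorem IsConvergent.exists_pair {f g : k⸨X⸩} (hf : IsConvergent f) (hg : IsConvergent g) :
    ∃ r : ℝ, 0 < r ∧ SummableAt r f ∧ SummableAt r g := by
  obtain ⟨r, hr0, hr⟩ := isConvergent_iff.mp hf
  obtain ⟨s, hs0, hs⟩ := isConvergent_iff.mp hg
  exact ⟨min r s, lt_min hr0 hs0, hr.mono (lt_min hr0 hs0) (min_le_left _ _),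
    hs.mono (lt_min hr0 hs0) (min_le_right _ _)⟩

theorem IsConvergent.add {f g : k⸨X⸩} (hf : IsConvergent f) (hg : IsConvergent g) :
    IsConvergent (f + g) := by
  obtain ⟨r, hr, h1, h2⟩ := hf.exists_pair hg
  exact isConvergent_iff.mpr ⟨r, hr, h1.add hr h2⟩

theorem IsConvergent.mul {f g : k⸨X⸩} (hf : IsConvergent f) (hg : IsConvergent g) :
    IsConvergent (f * g) := by
  obtain ⟨r, hr, h1, h2⟩ := hf.exists_pair hg
  exact isConvergent_iff.mpr ⟨r, hr, h1.mul hr h2⟩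

theorem isConvergent_single (m : ℤ) (c : k) : IsConvergent (HahnSeries.single m c : k⸨X⸩) :=
  isConvergent_iff.mpr ⟨1, one_pos, summableAt_single _ _ _⟩

theorem isConvergent_zero : IsConvergent (0 : k⸨X⸩) :=
  isConvergent_iff.mpr ⟨1, one_pos, summableAt_zero _⟩

/-- Partial sums of the weighted `ℓ¹` norm of a power series. -/
def partialNorm (r : ℝ) (N : ℕ) (g : PowerSeries k) : ℝ :=
  ∑ n ∈ Finset.range N, ‖PowerSeries.coeff n g‖ * r ^ n

variable {r : ℝ}

theorem partialNorm_nonneg (hr : 0 ≤ r) (N : ℕ) (g : PowerSeries k) : 0 ≤ partialNorm r N g :=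
  Finset.sum_nonneg fun n _ => by positivity

theorem partialNorm_mono (hr : 0 ≤ r) {s : ℝ} (hrs : r ≤ s) (N : ℕ) (g : PowerSeries k) :
    partialNorm r N g ≤ partialNorm s N g :=
  Finset.sum_le_sum fun n _ => by gcongr

theorem partialNorm_sum_le (hr : 0 ≤ r) (N : ℕ) {ι : Type*} (s : Finset ι)
    (g : ι → PowerSeries k) : partialNorm r N (∑ i ∈ s, g i) ≤ ∑ i ∈ s, partialNorm r N (g i) := by
  unfold partialNorm
  rw [Finset.sum_comm]
  refine Finset.sum_le_sum fun n _ => ?_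
  rw [← Finset.sum_mul, map_sum]
  gcongr
  exact norm_sum_le _ _

theorem partialNorm_mul_le (hr : 0 ≤ r) (N : ℕ) (f g : PowerSeries k) :
    partialNorm r N (f * g) ≤ partialNorm r N f * partialNorm r N g := by
  unfold partialNorm
  rw [Finset.sum_mul_sum, ← Finset.sum_product']
  calc _ ≤ ∑ n ∈ Finset.range N, ∑ p ∈ Finset.HasAntidiagonal.antidiagonal n,
        (‖PowerSeries.coeff p.1 f‖ * r ^ p.1) * (‖PowerSeries.coeff p.2 g‖ * r ^ p.2) := by
        refine Finset.sum_le_sum fun n _ => ?_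
        rw [PowerSeries.coeff_mul]
        calc _ ≤ (∑ p ∈ Finset.HasAntidiagonal.antidiagonal n,
              ‖PowerSeries.coeff p.1 f * PowerSeries.coeff p.2 g‖) * r ^ n := by
              gcongr
              exact norm_sum_le _ _
          _ = _ := by
              rw [Finset.sum_mul]
              refine Finset.sum_congr rfl fun p hp => ?_
              rw [← Finset.HasAntidiagonal.mem_antidiagonal.mp hp, norm_mul, pow_add]
              ring
    -- The triangle i + j < N lies in the square i, j < N, and all terms are nonnegative.
    _ ≤ _ := by
        refine le_trans (le_of_eq (Finset.sum_congr rfl fun n hn => ?_))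
          (Finset.sum_fiberwise_le_sum_of_sum_fiber_nonneg (t := Finset.range N)
            (g := fun p : ℕ × ℕ => p.1 + p.2) fun n _ =>
              Finset.sum_nonneg fun p _ => by positivity)
        refine Finset.sum_congr ?_ fun p _ => rfl
        ext p
        have := Finset.mem_range.mp hn
        simp only [Finset.HasAntidiagonal.mem_antidiagonal, Finset.mem_filter, Finset.mem_product,
          Finset.mem_range]
        omega

theorem partialNorm_one_le (r : ℝ) (N : ℕ) : partialNorm r N (1 : PowerSeries k) ≤ 1 := by
  unfold partialNorm
  cases N with
  | zero => simp
  | succ N => rw [Finset.sum_range_succ']; simp [PowerSeries.coeff_one]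

theorem partialNorm_pow_le (hr : 0 ≤ r) (N : ℕ) (g : PowerSeries k) (j : ℕ) :
    partialNorm r N (g ^ j) ≤ partialNorm r N g ^ j := by
  induction j with
  | zero => simpa using partialNorm_one_le r N
  | succ j ih =>
    rw [pow_succ, pow_succ]
    refine (partialNorm_mul_le hr N _ _).trans ?_
    gcongr
    exact partialNorm_nonneg hr _ _

/-- The factor h raises the truncation order by one and contributes a factor r. Both effects drive
the induction that bounds a solution of y = h G(y). -/
theorem partialNorm_X_mul (r : ℝ) (N : ℕ) (g : PowerSeries k) :
    partialNorm r (N + 1) (PowerSeries.X * g) = r * partialNorm r N g := by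
  unfold partialNorm
  rw [Finset.sum_range_succ', Finset.mul_sum]
  simp only [PowerSeries.coeff_succ_X_mul, PowerSeries.coeff_zero_X_mul, norm_zero, zero_mul,
    add_zero, pow_succ]
  exact Finset.sum_congr rfl fun n _ => by ring

theorem isConvergent_of_partialNorm_le (hr : 0 < r) (g : PowerSeries k) (C : ℝ)
    (h : ∀ N, partialNorm r N g ≤ C) : IsConvergent (HahnSeries.ofPowerSeries ℤ k g) := by
  refine isConvergent_iff.mpr ⟨r, hr, summableAt_ofPowerSeries.mpr ?_⟩
  exact summable_of_sum_range_le (fun n => by positivity) h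

theorem IsConvergent.exists_partialNorm_le {g : PowerSeries k}
    (h : IsConvergent (HahnSeries.ofPowerSeries ℤ k g)) :
    ∃ r : ℝ, 0 < r ∧ ∃ C, 0 ≤ C ∧ ∀ N, partialNorm r N g ≤ C := by
  obtain ⟨r, hr, hs⟩ := isConvergent_iff.mp h
  rw [summableAt_ofPowerSeries] at hs
  exact ⟨r, hr, _, tsum_nonneg fun n => by positivity,
    fun N => hs.sum_le_tsum _ fun n _ => by positivity⟩

/-- Since y - z divides G(y) - G(z), the map z ↦ X G(z) is an X-adic contraction. The n-th
coefficient of its iterates is constant from the iterate `Y (n + 1)` on, and these stable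
coefficients form the solution. -/
theorem exists_formal_fixedPoint {R : Type*} [CommRing R] (G : Polynomial (PowerSeries R)) :
    ∃ y : PowerSeries R, y = PowerSeries.X * G.eval y := by
  let Y : ℕ → PowerSeries R := fun n => (fun z => PowerSeries.X * G.eval z)^[n] 0
  have hY : ∀ n, Y (n + 1) = PowerSeries.X * G.eval (Y n) := fun n =>
    Function.iterate_succ_apply' _ _ _
  have key : ∀ n, PowerSeries.X ^ n ∣ Y (n + 1) - Y n := by
    intro n
    induction n with
    | zero => simp
    | succ n ih =>
      rw [hY (n + 1)]
      nth_rw 2 [hY n]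
      rw [← mul_sub, pow_succ']
      exact mul_dvd_mul_left _ (ih.trans (Polynomial.sub_dvd_eval_sub _ _ _))
  have key2 : ∀ n m, n ≤ m → PowerSeries.X ^ n ∣ Y m - Y n := by
    intro n m hnm
    induction m, hnm using Nat.le_induction with
    | base => simp
    | succ m hm ih =>
      have := dvd_add ((pow_dvd_pow _ hm).trans (key m)) ih
      simpa using this
  let y : PowerSeries R := PowerSeries.mk fun n => PowerSeries.coeff n (Y (n + 1))
  have hy : ∀ n, PowerSeries.X ^ n ∣ y - Y n := by
    intro n
    rw [PowerSeries.X_pow_dvd_iff]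
    intro m hm
    have := PowerSeries.X_pow_dvd_iff.mp (key2 (m + 1) n hm) m (by omega)
    rw [map_sub, sub_eq_zero] at this ⊢
    simp [y, this]
  refine ⟨y, ?_⟩
  rw [← sub_eq_zero]
  ext n
  have h : PowerSeries.X ^ (n + 1) ∣ y - PowerSeries.X * G.eval y := by
    have h1 := hy (n + 1)
    have h2 : PowerSeries.X ^ (n + 1) ∣ PowerSeries.X * (G.eval y - G.eval (Y n)) := by
      rw [pow_succ']
      exact mul_dvd_mul_left _ ((hy n).trans (Polynomial.sub_dvd_eval_sub _ _ _))
    have := dvd_sub h1 h2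
    rw [hY n] at this
    convert this using 1
    ring
  simpa using PowerSeries.X_pow_dvd_iff.mp h n (by omega)

theorem exists_common_partialNorm_le {ι : Type*} (s : Finset ι) (g : ι → PowerSeries k)
    (h : ∀ i ∈ s, IsConvergent (HahnSeries.ofPowerSeries ℤ k (g i))) :
    ∃ r : ℝ, 0 < r ∧ ∃ C, 0 ≤ C ∧ ∀ N, ∑ i ∈ s, partialNorm r N (g i) ≤ C := by
  classical
  induction s using Finset.induction_on with
  | empty => exact ⟨1, one_pos, 0, le_rfl, by simp⟩
  | insert a s ha ih =>
    obtain ⟨r, hr, C, hC, h1⟩ := ih fun i hi => h i (Finset.mem_insert_of_mem hi)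
    obtain ⟨r', hr', C', hC', h1'⟩ := (h a (Finset.mem_insert_self _ _)).exists_partialNorm_le
    have hm : 0 < min r r' := lt_min hr hr'
    refine ⟨min r r', hm, C' + C, by positivity, fun N => ?_⟩
    rw [Finset.sum_insert ha]
    refine add_le_add ((partialNorm_mono hm.le (min_le_right _ _) _ _).trans (h1' N)) ?_
    exact (Finset.sum_le_sum fun i _ => partialNorm_mono hm.le (min_le_left _ _) _ _).trans (h1 N)

/-- A polynomial fixed-point equation with convergent coefficients has a convergent solution. -/
theorem exists_convergent_fixedPoint (G : Polynomial (PowerSeries k))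
    (hG : ∀ j, IsConvergent (HahnSeries.ofPowerSeries ℤ k (G.coeff j))) :
    ∃ y : PowerSeries k, y = PowerSeries.X * G.eval y ∧
      IsConvergent (HahnSeries.ofPowerSeries ℤ k y) := by
  obtain ⟨y, hy⟩ := exists_formal_fixedPoint G
  refine ⟨y, hy, ?_⟩
  obtain ⟨r₀, hr₀, C, hC, h⟩ := exists_common_partialNorm_le G.support G.coeff fun j _ => hG j
  -- The radius is chosen so that rC ≤ 1. If the partial norm of y of order N is at most 1, then
  -- that of order N + 1 is r times that of G(y) of order N, hence at most r ∑ ‖Gⱼ‖ ≤ rC ≤ 1.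
  set r := min r₀ (1 / (C + 1)) with hr
  have hr0 : 0 < r := lt_min hr₀ (by positivity)
  have hrC : r * C ≤ 1 := by
    calc r * C ≤ 1 / (C + 1) * C := by gcongr; exact min_le_right _ _
      _ ≤ 1 := by rw [one_div, inv_mul_le_iff₀ (by positivity)]; linarith
  refine isConvergent_of_partialNorm_le hr0 y 1 fun N => ?_
  induction N with
  | zero => simp [partialNorm]
  | succ N ih =>
    rw [hy, partialNorm_X_mul]
    refine le_trans ?_ hrC
    gcongr
    refine le_trans ?_ (h N)
    rw [Polynomial.eval_eq_sum, Polynomial.sum]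
    refine (partialNorm_sum_le hr0.le N _ _).trans (Finset.sum_le_sum fun j _ => ?_)
    calc _ ≤ partialNorm r N (G.coeff j) * partialNorm r N y ^ j :=
          (partialNorm_mul_le hr0.le _ _ _).trans (by
            gcongr
            · exact partialNorm_nonneg hr0.le _ _
            · exact partialNorm_pow_le hr0.le _ _ _)
      _ ≤ partialNorm r₀ N (G.coeff j) * 1 := by
          refine mul_le_mul (partialNorm_mono hr0.le (min_le_left _ _) _ _)
            (pow_le_one₀ (partialNorm_nonneg hr0.le _ _) ih)
            (pow_nonneg (partialNorm_nonneg hr0.le _ _) _) (partialNorm_nonneg hr₀.le _ _)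
      _ = _ := mul_one _

/-- The series y = (1 - Xg)⁻¹ - 1 is the solution of y = X(g + gy), a fixed-point equation with
convergent coefficients. -/
theorem isConvergent_inv_one_sub {g : PowerSeries k}
    (hg : IsConvergent (HahnSeries.ofPowerSeries ℤ k g)) :
    IsConvergent (1 - HahnSeries.ofPowerSeries ℤ k (PowerSeries.X * g) : k⸨X⸩)⁻¹ := by
  obtain ⟨y, hy, hyc⟩ := exists_convergent_fixedPoint
    (Polynomial.C g + Polynomial.C g * Polynomial.X) (by
      intro j
      simp only [Polynomial.coeff_add, Polynomial.coeff_C, Polynomial.coeff_C_mul,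
        Polynomial.coeff_X, map_add]
      refine IsConvergent.add ?_ ?_
      · split_ifs <;> simp [hg, isConvergent_zero]
      · split_ifs <;> simp [hg, isConvergent_zero])
  have : (1 - HahnSeries.ofPowerSeries ℤ k (PowerSeries.X * g) : k⸨X⸩)⁻¹ =
      1 + HahnSeries.ofPowerSeries ℤ k y := by
    refine inv_eq_of_mul_eq_one_left ?_
    rw [← map_one (HahnSeries.ofPowerSeries ℤ k), ← map_sub, ← map_add, ← map_mul]
    congr 1
    simp at hy
    linear_combination hy
  rw [this]
  exact (isConvergent_single 0 1).add hyc

theorem IsConvergent.inv {f : k⸨X⸩} (hf : IsConvergent f) : IsConvergent f⁻¹ := by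
  rcases eq_or_ne f 0 with rfl | hf0
  · simpa using isConvergent_zero
  set c := f.coeff f.order with hc
  have hc0 : c ≠ 0 := HahnSeries.coeff_order_eq_zero.not.mpr hf0
  -- Division by the leading term reduces to a series of the form 1 - Xg.
  set u : k⸨X⸩ := HahnSeries.single (-f.order) c⁻¹ * f with hu
  have hu' : IsConvergent u := (isConvergent_single _ _).mul hf
  obtain ⟨g, hg⟩ : ∃ g : PowerSeries k,
      u = 1 - HahnSeries.ofPowerSeries ℤ k (PowerSeries.X * g) := by
    have : u = HahnSeries.ofPowerSeries ℤ k (PowerSeries.C c⁻¹ * f.powerSeriesPart) := by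
      rw [map_mul, LaurentSeries.ofPowerSeries_powerSeriesPart, HahnSeries.ofPowerSeries_C,
        HahnSeries.C_apply, ← mul_assoc, HahnSeries.single_mul_single]
      simp [u]
    obtain ⟨g, hg⟩ : PowerSeries.X ∣ 1 - PowerSeries.C c⁻¹ * f.powerSeriesPart := by
      rw [PowerSeries.X_dvd_iff]
      rw [map_sub, map_mul, map_one, ← PowerSeries.coeff_zero_eq_constantCoeff_apply
        f.powerSeriesPart, LaurentSeries.powerSeriesPart_coeff]
      simp [← hc, hc0]
    refine ⟨g, ?_⟩
    rw [← hg, map_sub, map_one, this]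
    ring
  have hgc : IsConvergent (HahnSeries.ofPowerSeries ℤ k g) := by
    have h1 : HahnSeries.ofPowerSeries ℤ k g = HahnSeries.single (-1) 1 * (1 + (-1 : k⸨X⸩) * u) := by
      rw [hg, map_mul, HahnSeries.ofPowerSeries_X]
      ring_nf
      rw [HahnSeries.single_mul_single]
      simp
    rw [h1]
    refine (isConvergent_single _ _).mul ((isConvergent_single 0 1).add (IsConvergent.mul ?_ hu'))
    have := isConvergent_single 0 (-1 : k)
    simpa using this
  have : f⁻¹ = HahnSeries.single (-f.order) c⁻¹ * u⁻¹ := by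
    rw [hu, mul_inv, ← mul_assoc, mul_inv_cancel₀, one_mul]
    simp [hc0]
  rw [this]
  refine (isConvergent_single _ _).mul ?_
  rw [hg]
  exact isConvergent_inv_one_sub hgc

variable (k) in
/-- The field `k({h})` of convergent Laurent series. -/
def convergentSeries : IntermediateField k k⸨X⸩ where
  carrier := {f | IsConvergent f}
  mul_mem' := IsConvergent.mul
  add_mem' := IsConvergent.add
  algebraMap_mem' c := by
    rw [LaurentSeries.algebraMap_apply]
    exact isConvergent_single 0 c
  inv_mem' _ := IsConvergent.inv

theorem mem_convergentSeries {f : k⸨X⸩} : f ∈ convergentSeries k ↔ IsConvergent f := Iff.rfl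

theorem rationalFunctions_le_convergentSeries : rationalFunctions k ≤ convergentSeries k := by
  rw [rationalFunctions, IntermediateField.adjoin_le_iff]
  rintro _ rfl
  exact isConvergent_single 1 1

end Convergent

/-! ### Infinite transcendence degree of the convergent series -/

section Transcendence

open AlgebraicIndependent in
theorem countable_matroid_closure {A : Type*} [CommRing A] [IsDomain A] [Algebra ℚ A]
    {s : Set A} (hs : s.Countable) : ((matroid ℚ A).closure s).Countable := by
  have hc : Countable (Algebra.adjoin ℚ s) := by
    have : Countable s := hs
    rw [← Cardinal.mk_le_aleph0_iff]
    rw [← Cardinal.lift_le_aleph0]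
    refine (Algebra.lift_cardinalMk_adjoin_le ℚ s).trans ?_
    simp
  rw [matroid_closure_eq]
  exact Algebraic.countable (Algebra.adjoin ℚ s) A

/-- The power series with coefficients in `{0, 1}` attached to a set of exponents. -/
def indicatorSeries (A : Set ℕ) : PowerSeries ℚ := PowerSeries.mk (A.indicator 1)

theorem indicatorSeries_injective : Function.Injective indicatorSeries := by
  intro A B h
  refine Set.indicator_one_inj ℚ ?_
  funext n
  simpa [indicatorSeries] using congrArg (PowerSeries.coeff n) h

open AlgebraicIndependent in
-- There are uncountably many 0-1 series, whereas the elements algebraic over a countably generated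
-- ℚ-algebra form a countable set. A transcendence basis of the 0-1 series therefore cannot be
-- finite.
theorem exists_infinite_algebraicIndependent_indicatorSeries :
    ∃ T : Set (PowerSeries ℚ), T ⊆ Set.range indicatorSeries ∧ T.Infinite ∧
      AlgebraicIndependent ℚ ((↑) : T → PowerSeries ℚ) := by
  obtain ⟨T, hT⟩ := (matroid ℚ (PowerSeries ℚ)).exists_isBasis (Set.range indicatorSeries)
    (by simp)
  refine ⟨T, hT.subset, fun hfin => ?_, matroid_indep_iff.mp hT.indep⟩
  have h : (Set.range indicatorSeries).Countable :=
    (countable_matroid_closure hfin.countable).mono hT.subset_closure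
  have h2 : Countable (Set ℕ) := by
    have : Countable (Set.range indicatorSeries) := h
    exact (Set.rangeFactorization_injective.mpr indicatorSeries_injective).countable
  rw [← Cardinal.mk_le_aleph0_iff, Cardinal.mk_set, Cardinal.mk_nat] at h2
  exact (Cardinal.cantor _).not_ge h2

/-- The series have rational coefficients, so a ℚ-linear functional k → ℚ applied to the
coefficients of a relation over k gives a relation over ℚ, which is trivial. The functionals
separate the points of k. -/
theorem algebraicIndependent_map_powerSeries {k : Type*} [Field k] [Algebra ℚ k] {ι : Type*}
    {x : ι → PowerSeries ℚ} (hx : AlgebraicIndependent ℚ x) :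
    AlgebraicIndependent k fun i => PowerSeries.map (algebraMap ℚ k) (x i) := by
  rw [algebraicIndependent_iff]
  intro p hp
  ext d
  rw [MvPolynomial.coeff_zero, ← Module.forall_dual_apply_eq_zero_iff ℚ]
  intro f
  set q : MvPolynomial ι ℚ := ∑ e ∈ p.support, MvPolynomial.monomial e (f (p.coeff e)) with hq
  have hq0 : q = 0 := by
    refine (algebraicIndependent_iff.mp hx) q ?_
    ext n
    have h1 : PowerSeries.coeff n (MvPolynomial.aeval x q) = f (PowerSeries.coeff n
        (MvPolynomial.aeval (fun i => PowerSeries.map (algebraMap ℚ k) (x i)) p)) := by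
      rw [hq, map_sum, map_sum, MvPolynomial.aeval_def _ p, MvPolynomial.eval₂_eq, map_sum, map_sum]
      refine Finset.sum_congr rfl fun e _ => ?_
      rw [MvPolynomial.aeval_monomial]
      simp only [← map_pow, Finsupp.prod]
      rw [← map_prod, ← Algebra.smul_def, ← Algebra.smul_def, PowerSeries.coeff_smul,
        PowerSeries.coeff_smul, PowerSeries.coeff_map, smul_eq_mul, smul_eq_mul, mul_comm _ (algebraMap ℚ k _),
        ← Algebra.smul_def, map_smul, smul_eq_mul, mul_comm]
    rw [h1, hp]
    simp
  have h2 := congrArg (MvPolynomial.coeff d) hq0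
  rw [hq, MvPolynomial.coeff_sum] at h2
  classical
  simp only [MvPolynomial.coeff_monomial, Finset.sum_ite_eq', MvPolynomial.coeff_zero] at h2
  by_cases hd : d ∈ p.support
  · simpa [hd] using h2
  · rw [MvPolynomial.notMem_support_iff.mp hd, map_zero]

open AlgebraicIndependent in
-- Otherwise T would lie in the closure of a finite set in the matroid of algebraic independence,
-- and its rank would be finite.
theorem exists_mem_transcendental_of_infinite {k K : Type*} [Field k] [Field K] [Algebra k K]
    {T : Set K} (hinf : T.Infinite) (hind : AlgebraicIndependent k ((↑) : T → K))
    (M : IntermediateField k K) (hM : M.FG) : ∃ z ∈ T, Transcendental M z := by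
  obtain ⟨s, rfl⟩ := hM
  by_contra! hcon
  have hTs : T ⊆ (matroid k K).closure s := by
    intro x hx
    rw [matroid_closure_eq]
    have := not_not.mp (hcon x hx)
    rwa [IntermediateField.isAlgebraic_adjoin_iff] at this
  have h1 := (matroid_indep_iff.mpr hind).encard_le_eRk_of_subset hTs
  rw [Matroid.eRk_closure_eq] at h1
  have h2 := h1.trans ((matroid k K).eRk_le_encard s)
  rw [hinf.encard_eq] at h2
  simp at h2

variable {k : Type*} [NontriviallyNormedField k] [CharZero k]

variable (k) in
theorem exists_infinite_algebraicIndependent_convergent :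
    ∃ T : Set k⸨X⸩, T.Infinite ∧ T ⊆ convergentSeries k ∧
      AlgebraicIndependent k ((↑) : T → k⸨X⸩) := by
  obtain ⟨T, hT, hinf, hind⟩ := exists_infinite_algebraicIndependent_indicatorSeries
  have h1 := algebraicIndependent_map_powerSeries (k := k) hind
  let e : PowerSeries k →ₐ[k] k⸨X⸩ :=
    { HahnSeries.ofPowerSeries ℤ k with
      commutes' := fun c => by
        rw [LaurentSeries.algebraMap_apply]
        exact HahnSeries.ofPowerSeries_C c }
  have he : Function.Injective e := HahnSeries.ofPowerSeries_injective
  have h2 := h1.map' he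
  refine ⟨_, ?_, ?_, h2.to_subtype_range⟩
  · have : Infinite T := hinf.to_subtype
    exact Set.infinite_range_of_injective h2.injective
  · rintro _ ⟨t, rfl⟩
    obtain ⟨A, hA⟩ := hT t.2
    refine isConvergent_iff.mpr ⟨1 / 2, by norm_num, summableAt_ofPowerSeries.mpr ?_⟩
    refine Summable.of_nonneg_of_le (fun n => by positivity) (fun n => ?_)
      (summable_geometric_two)
    change ‖PowerSeries.coeff n (PowerSeries.map (algebraMap ℚ k) t)‖ * _ ≤ _
    rw [← hA]
    by_cases hn : n ∈ A <;> simp [indicatorSeries, hn]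

/-- The field of convergent series is not algebraic over a finitely generated subfield. -/
theorem exists_convergent_transcendental (M : IntermediateField k k⸨X⸩) (hM : M.FG) :
    ∃ z : k⸨X⸩, IsConvergent z ∧ Transcendental M z := by
  obtain ⟨T, hinf, hT, hind⟩ := exists_infinite_algebraicIndependent_convergent k
  obtain ⟨z, hz, h⟩ := exists_mem_transcendental_of_infinite hinf hind M hM
  exact ⟨z, hT hz, h⟩

end Transcendence

/-! ### The h-adic topology in terms of congruences -/

section Neighbourhoods

variable {k : Type*} [Field k]

theorem congrMod_iff_valuation {m : ℕ} {f g : k⸨X⸩} :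
    CongrMod m f g ↔ Valued.v (f - g) ≤ WithZero.exp (-(m : ℤ)) := by
  have hv := LaurentSeries.valuation_single_zpow k (m : ℤ)
  constructor
  · rintro ⟨q, hq⟩
    rw [hq, map_mul, hv]
    exact mul_le_of_le_one_right' ((LaurentSeries.val_le_one_iff_eq_coe k _).mpr ⟨q, rfl⟩)
  · intro h
    have h1 : Valued.v (HahnSeries.single (-(m : ℤ)) 1 * (f - g) : k⸨X⸩) ≤ 1 := by
      rw [map_mul, LaurentSeries.valuation_single_zpow, neg_neg]
      calc _ ≤ WithZero.exp (m : ℤ) * WithZero.exp (-(m : ℤ)) := by gcongr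
        _ = 1 := by rw [← WithZero.exp_add]; simp
    obtain ⟨q, hq⟩ := (LaurentSeries.val_le_one_iff_eq_coe k _).mp h1
    refine ⟨q, ?_⟩
    rw [hq, ← mul_assoc, HahnSeries.single_mul_single]
    simp

theorem mem_nhds_iff_congrMod {U : Set k⸨X⸩} {x : k⸨X⸩} :
    U ∈ 𝓝 x ↔ ∃ m : ℕ, ∀ y, CongrMod m y x → y ∈ U := by
  simp only [congrMod_iff_valuation]
  rw [Valued.mem_nhds]
  constructor
  · rintro ⟨γ, hγ⟩
    simp only [Valuation.restrict_lt_iff_lt_embedding] at hγ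
    set δ := MonoidWithZeroHom.ValueGroup₀.embedding γ.1 with hδ
    have hδ0 : δ ≠ 0 := by simp [hδ]
    -- The neighbourhood is given by a strict inequality, so -m < log δ is needed; the summand 1
    -- provides it.
    refine ⟨(1 - WithZero.log δ).toNat, fun y hy => hγ (lt_of_le_of_lt hy ?_)⟩
    rw [← WithZero.exp_log hδ0, WithZero.exp_lt_exp]
    simp only [WithZero.log_exp]
    omega
  · rintro ⟨m, hm⟩
    have h0 : (Valued.v : Valuation k⸨X⸩ _).restrict (HahnSeries.single (m : ℤ) 1) ≠ 0 := by
      rw [Valuation.ne_zero_iff]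
      simp
    refine ⟨Units.mk0 _ h0, fun y hy => hm y ?_⟩
    have := (Valuation.restrict_lt_iff _).mp hy
    rw [LaurentSeries.valuation_single_zpow] at this
    exact this.le

theorem setOf_congrMod_mem_nhds (m : ℕ) (x : k⸨X⸩) : {y | CongrMod m y x} ∈ 𝓝 x :=
  mem_nhds_iff_congrMod.mpr ⟨m, fun _ h => h⟩

theorem CongrMod.symm {m : ℕ} {f g : k⸨X⸩} (h : CongrMod m f g) : CongrMod m g f := by
  obtain ⟨q, hq⟩ := h
  exact ⟨-q, by rw [map_neg, mul_neg, ← hq, neg_sub]⟩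

theorem CongrMod.trans {m : ℕ} {f g e : k⸨X⸩} (h : CongrMod m f g) (h' : CongrMod m g e) :
    CongrMod m f e := by
  obtain ⟨q, hq⟩ := h
  obtain ⟨q', hq'⟩ := h'
  exact ⟨q + q', by rw [map_add, mul_add, ← hq, ← hq']; ring⟩

theorem tendsto_X_pow : Tendsto (fun n : ℕ => (HahnSeries.single 1 1 : k⸨X⸩) ^ n) atTop (𝓝 0) := by
  intro U hU
  obtain ⟨m, hm⟩ := mem_nhds_iff_congrMod.mp hU
  refine mem_map.mpr ((eventually_ge_atTop m).mono fun n hn => hm _ ⟨PowerSeries.X ^ (n - m), ?_⟩)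
  change HahnSeries.single 1 1 ^ n - 0 = _
  rw [map_pow, HahnSeries.ofPowerSeries_X, RatFunc.single_one_eq_pow, ← pow_add, sub_zero]
  congr 1
  omega

/-- The set `h k[[h]]` is a neighbourhood of each of its points. -/
theorem setOf_X_mul_mem_nhds {x : k⸨X⸩} (hx : CongrMod 1 x 0) : {y | CongrMod 1 y 0} ∈ 𝓝 x := by
  filter_upwards [setOf_congrMod_mem_nhds 1 x] with y hy using hy.trans hx

end Neighbourhoods

/-! ### Hensel's lemma with convergent roots -/

section Roots

/-- The polynomial of degree less than `n` with the given coefficients. -/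
def polyOf {R : Type*} [CommRing R] (n : ℕ) (c : ℕ → R) : Polynomial R :=
  ∑ i ∈ Finset.range n, Polynomial.C (c i) * Polynomial.X ^ i

theorem natDegree_polyOf_lt {R : Type*} [CommRing R] {n : ℕ} (hn : 0 < n) (c : ℕ → R) :
    (polyOf n c).natDegree < n := by
  rw [Nat.lt_iff_le_pred hn]
  refine Polynomial.natDegree_sum_le_of_forall_le _ _ fun i hi => ?_
  refine (Polynomial.natDegree_C_mul_X_pow_le _ _).trans ?_
  have := Finset.mem_range.mp hi
  omega

/-- With the number of terms fixed, a Taylor coefficient is a polynomial in finitely many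
coefficients and the base point. This turns Hensel's estimates into open conditions on both. -/
theorem continuous_taylor_coeff_polyOf {R : Type*} [CommRing R] [TopologicalSpace R]
    [IsTopologicalRing R] (n j : ℕ) :
    Continuous fun p : (ℕ → R) × R => (Polynomial.taylor p.2 (polyOf n p.1)).coeff j := by
  simp only [Polynomial.taylor_coeff, polyOf]
  simp only [map_sum, Polynomial.eval_finsetSum]
  refine continuous_finsetSum _ fun i _ => ?_
  simp only [← Polynomial.smul_eq_C_mul, map_smul, Polynomial.eval_smul, smul_eq_mul]
  refine Continuous.mul (by fun_prop) ?_
  exact (Polynomial.continuous _).comp continuous_snd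

variable {k : Type*} [NontriviallyNormedField k]

theorem dense_rationalFunctions : Dense (rationalFunctions k : Set k⸨X⸩) := by
  refine Dense.mono ?_ (LaurentSeries.coe_range_dense (K := k))
  rintro _ ⟨f, rfl⟩
  induction f using RatFunc.induction_on with
  | f p q hq =>
    rw [RatFunc.algebraMap_apply_div]
    have h : ∀ p : Polynomial k, algebraMap (Polynomial k) k⸨X⸩ p ∈ rationalFunctions k := by
      intro p
      have : algebraMap (Polynomial k) k⸨X⸩ p =
          Polynomial.aeval (HahnSeries.single 1 1 : k⸨X⸩) p := by
        rw [HahnSeries.algebraMap_apply']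
        induction p using Polynomial.induction_on' with
        | add p q hp hq => rw [map_add, map_add, map_add, hp, hq]
        | monomial n c =>
          rw [Polynomial.aeval_monomial, LaurentSeries.algebraMap_apply,
            ← Polynomial.C_mul_X_pow_eq_monomial, map_mul, map_mul, map_pow, map_pow]
          congr 1
          · rw [← HahnSeries.ofPowerSeries_C (Γ := ℤ)]
            congr 1
            exact Polynomial.coe_C c
          · rw [← HahnSeries.ofPowerSeries_X (Γ := ℤ)]
            congr 2
            exact Polynomial.coe_X
      rw [this]
      exact IntermediateField.algebra_adjoin_le_adjoin _ _
        (Polynomial.aeval_mem_adjoin_singleton k (HahnSeries.single 1 1 : k⸨X⸩))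
    exact div_mem (h p) (h q)

/-- Taylor expansion: a polynomial whose coefficients at `a` satisfy the estimates of Hensel's
lemma has a convergent root near `a`. -/
theorem exists_root_of_taylor {P : Polynomial k⸨X⸩} {n : ℕ} (hn : P.natDegree < n)
    {a u : k⸨X⸩} (ha : IsConvergent a) (hu : IsConvergent u) (hu0 : u ≠ 0)
    (hP : ∀ j, IsConvergent (P.coeff j))
    (h1 : (Polynomial.taylor a P).coeff 1 ≠ 0)
    (h : ∀ j < n, j ≠ 1 → CongrMod 1
      ((Polynomial.taylor a P).coeff j / ((Polynomial.taylor a P).coeff 1 * u) * u ^ j) 0) :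
    ∃ q : PowerSeries k, IsConvergent (a + u * HahnSeries.ofPowerSeries ℤ k q) ∧
      P.eval (a + u * HahnSeries.ofPowerSeries ℤ k q) = 0 := by
  set Q := Polynomial.taylor a P with hQ
  have hQc : ∀ j, Q.coeff j ∈ convergentSeries k := by
    intro j
    rw [hQ, Polynomial.taylor_coeff, Polynomial.eval_eq_sum, Polynomial.sum]
    refine sum_mem fun i _ => mul_mem ?_ (pow_mem ha _)
    rw [Polynomial.hasseDeriv_coeff]
    exact mul_mem (natCast_mem _ _) (hP _)
  have hQn : Q.natDegree < n := by rwa [hQ, Polynomial.natDegree_taylor]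
  have h1n : 1 < n := lt_of_le_of_lt (Polynomial.le_natDegree_of_ne_zero h1) hQn
  -- Dividing P(a + uz) = ∑ Qⱼ uʲ zʲ by d isolates the linear term: z = -∑ (Qⱼ uʲ / d) zʲ over j ≠
  -- 1. By hypothesis these coefficients lie in h k[[h]], so the equation reads z = h G(z).
  set d := Q.coeff 1 * u with hd
  have hd0 : d ≠ 0 := mul_ne_zero h1 hu0
  have hd' : d ∈ convergentSeries k := mul_mem (hQc 1) hu
  have h' : ∀ j, ∃ q : PowerSeries k, j < n → j ≠ 1 →
      -(Q.coeff j / d * u ^ j) = HahnSeries.ofPowerSeries ℤ k (PowerSeries.X * q) := by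
    intro j
    by_cases hj : j < n ∧ j ≠ 1
    · obtain ⟨q, hq⟩ := h j hj.1 hj.2
      refine ⟨-q, fun _ _ => ?_⟩
      rw [sub_zero] at hq
      rw [hq, map_mul, HahnSeries.ofPowerSeries_X, map_neg, mul_neg]
      rfl
    · exact ⟨0, fun h1 h2 => absurd ⟨h1, h2⟩ hj⟩
  choose q hq using h'
  set e : ℕ → PowerSeries k := fun j => if j = 1 then 0 else q j with he
  have hec : ∀ j < n, HahnSeries.ofPowerSeries ℤ k (e j) ∈ convergentSeries k := by
    intro j hj
    simp only [he]
    split_ifs with hj1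
    · rw [map_zero]; exact zero_mem _
    · have h2 := hq j hj hj1
      have h3 : HahnSeries.ofPowerSeries ℤ k (q j) =
          (HahnSeries.single 1 1 : k⸨X⸩)⁻¹ * -(Q.coeff j / d * u ^ j) := by
        rw [h2, map_mul, HahnSeries.ofPowerSeries_X, inv_mul_cancel_left₀]
        simp
      rw [h3]
      exact mul_mem (inv_mem (isConvergent_single 1 1))
        (neg_mem (mul_mem (div_mem (hQc j) hd') (pow_mem hu j)))
  obtain ⟨y, hy, hyc⟩ := exists_convergent_fixedPoint (polyOf n e) (by
    intro j
    have : (polyOf n e).coeff j = if j < n then e j else 0 := by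
      simp [polyOf, Polynomial.coeff_X_pow]
    rw [this]
    split_ifs with hj
    · exact hec j hj
    · rw [map_zero]; exact isConvergent_zero)
  refine ⟨y, ha.add (hu.mul hyc), ?_⟩
  set z := HahnSeries.ofPowerSeries ℤ k y with hz
  have hzeq : z = ∑ j ∈ Finset.range n, (if j = 1 then 0 else -(Q.coeff j / d * u ^ j)) * z ^ j := by
    conv_lhs => rw [hz, hy, polyOf, Polynomial.eval_finsetSum, Finset.mul_sum, map_sum]
    refine Finset.sum_congr rfl fun j hj => ?_
    rw [Polynomial.eval_mul, Polynomial.eval_C, Polynomial.eval_pow, Polynomial.eval_X,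
      ← mul_assoc, map_mul, map_pow]
    congr 1
    simp only [he]
    split_ifs with hj1
    · simp
    · rw [hq j (Finset.mem_range.mp hj) hj1]
  have key : P.eval (a + u * z) = Q.eval (u * z) := by
    rw [hQ, Polynomial.taylor_eval, add_comm]
  rw [key, Polynomial.eval_eq_sum_range' hQn]
  have h2 : ∀ j ∈ Finset.range n, Q.coeff j * (u * z) ^ j =
      (if j = 1 then d * z else 0) -
        d * ((if j = 1 then 0 else -(Q.coeff j / d * u ^ j)) * z ^ j) := by
    intro j _
    split_ifs with hj1
    · subst hj1; rw [hd]; ring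
    · field_simp
      ring
  rw [Finset.sum_congr rfl h2, Finset.sum_sub_distrib, ← Finset.mul_sum, ← hzeq,
    Finset.sum_ite_eq', if_pos (Finset.mem_range.mpr h1n), sub_self]

/-- At (c₀, α) the Taylor coefficient of index 0 vanishes and that of index 1 does not. After
scaling by a high power u of h, the estimates of `exists_root_of_taylor` hold there, hence also at
all nearby (c, a). The base point a can be taken in k(h), which is dense, and is then convergent
even though α need not be. -/
theorem exists_convergent_root_near {n : ℕ} {c₀ : ℕ → k⸨X⸩} {α : k⸨X⸩}
    (h0 : (polyOf n c₀).eval α = 0) (h1 : (polyOf n c₀).derivative.eval α ≠ 0)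
    {W : Set k⸨X⸩} (hW : W ∈ 𝓝 α) :
    ∀ᶠ c in 𝓝 c₀, (∀ j, IsConvergent (c j)) →
      ∃ β ∈ W, IsConvergent β ∧ (polyOf n c).eval β = 0 := by
  have hn : 0 < n := by
    rcases Nat.eq_zero_or_pos n with rfl | h
    · simp [polyOf] at h1
    · exact h
  obtain ⟨m, hm⟩ := mem_nhds_iff_congrMod.mp hW
  let D : ℕ → (ℕ → k⸨X⸩) × k⸨X⸩ → k⸨X⸩ := fun j p =>
    (Polynomial.taylor p.2 (polyOf n p.1)).coeff j
  have hD : ∀ j, Continuous (D j) := continuous_taylor_coeff_polyOf n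
  have hD0 : D 0 (c₀, α) = 0 := by simpa [D] using h0
  have hD1 : D 1 (c₀, α) ≠ 0 := by simpa [D, Polynomial.taylor_coeff_one] using h1
  have hS0 : (HahnSeries.single 1 1 : k⸨X⸩) ≠ 0 := by simp
  have hnice : ∀ x : k⸨X⸩, ∀ᶠ s : ℕ in atTop,
      CongrMod 1 (x * (HahnSeries.single 1 1 : k⸨X⸩) ^ s) 0 := by
    intro x
    have : Tendsto (fun s : ℕ => x * (HahnSeries.single 1 1 : k⸨X⸩) ^ s) atTop (𝓝 0) := by
      simpa using tendsto_X_pow.const_mul x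
    exact this (setOf_congrMod_mem_nhds 1 0)
  -- For u = hˢ, dividing by the linear term leaves a factor u^(j-1), which is small for j ≥ 2. The
  -- condition m ≤ s keeps the root a + uq congruent to a modulo hᵐ.
  obtain ⟨s, hsm, hs⟩ : ∃ s : ℕ, m ≤ s ∧ ∀ j < n, 2 ≤ j →
      CongrMod 1 (D j (c₀, α) / D 1 (c₀, α) * (HahnSeries.single 1 1 : k⸨X⸩) ^ (s * (j - 1))) 0 := by
    have h2 : ∀ᶠ s : ℕ in atTop, ∀ j ∈ Finset.range n, 2 ≤ j →
      CongrMod 1 (D j (c₀, α) / D 1 (c₀, α) *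
        (HahnSeries.single 1 1 : k⸨X⸩) ^ (s * (j - 1))) 0 := by
      rw [eventually_all_finset]
      intro j _
      rw [eventually_imp_distrib_left]
      intro hj
      exact (tendsto_id.atTop_mul_const' (by omega : 0 < j - 1)).eventually
        (hnice (D j (c₀, α) / D 1 (c₀, α)))
    obtain ⟨s, h3, h4⟩ := (h2.and (eventually_ge_atTop m)).exists
    exact ⟨s, h4, fun j hj => h3 j (Finset.mem_range.mpr hj)⟩
  set u : k⸨X⸩ := (HahnSeries.single 1 1 : k⸨X⸩) ^ s with hu
  have hu0 : u ≠ 0 := pow_ne_zero _ hS0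
  have hmain : ∀ᶠ p in 𝓝 (c₀, α), D 1 p ≠ 0 ∧ CongrMod m p.2 α ∧
      ∀ j ∈ Finset.range n, j ≠ 1 → CongrMod 1 (D j p / (D 1 p * u) * u ^ j) 0 := by
    refine ((hD 1).continuousAt.eventually_ne hD1).and (Eventually.and ?_ ?_)
    · exact (continuous_snd.tendsto (c₀, α)).eventually (setOf_congrMod_mem_nhds m α)
    · rw [eventually_all_finset]
      intro j hj
      rw [eventually_imp_distrib_left]
      intro hj1
      have hc : ContinuousAt (fun p => D j p / (D 1 p * u) * u ^ j) (c₀, α) :=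
        (((hD j).continuousAt).div (((hD 1).continuousAt).mul continuousAt_const)
          (mul_ne_zero hD1 hu0)).mul continuousAt_const
      refine hc (setOf_X_mul_mem_nhds ?_)
      rcases Nat.eq_zero_or_pos j with rfl | hj0
      · simp only [hD0]
        exact ⟨0, by simp⟩
      · have := hs j (Finset.mem_range.mp hj) (by omega)
        convert this using 1
        rw [pow_mul, ← hu]
        obtain ⟨i, rfl⟩ : ∃ i, j = i + 1 := ⟨j - 1, by omega⟩
        rw [Nat.add_sub_cancel, pow_succ]
        field_simp
  -- Currying fixes c first; the base point a may then depend on c.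
  filter_upwards [hmain.curry_nhds] with c hc hconv
  obtain ⟨a, ha, h2, h3, h4⟩ := (dense_rationalFunctions (k := k)).inter_nhds_nonempty hc
  have hcoeff : ∀ j, IsConvergent ((polyOf n c).coeff j) := by
    intro j
    have : (polyOf n c).coeff j = if j < n then c j else 0 := by
      simp [polyOf, Polynomial.coeff_X_pow]
    rw [this]
    split_ifs
    · exact hconv j
    · exact isConvergent_zero
  obtain ⟨q, hq, hroot⟩ := exists_root_of_taylor (natDegree_polyOf_lt hn c)
    (rationalFunctions_le_convergentSeries ha)
    (pow_mem (mem_convergentSeries.mpr (isConvergent_single 1 1)) s)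
    hu0 hcoeff h2 fun j hj => h4 j (Finset.mem_range.mpr hj)
  refine ⟨_, hm _ (CongrMod.trans ⟨PowerSeries.X ^ (s - m) * q, ?_⟩ h3), hq, hroot⟩
  rw [add_sub_cancel_left, map_mul, map_pow, HahnSeries.ofPowerSeries_X,
    RatFunc.single_one_eq_pow, ← mul_assoc, ← pow_add, Nat.add_sub_cancel' hsm]

end Roots

/-! ### Extending embeddings to a simple extension -/

section Extension

theorem exists_extension_of_root {F E E' : Type*} [Field F] [Field E] [Field E'] [Algebra F E]
    (φ : F →+* E') {α : E} {β : E'} (hα : IsIntegral F α) (hβ : (minpoly F α).eval₂ φ β = 0) :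
    ∃ ψ : IntermediateField.adjoin F {α} →+* E', (∀ x, ψ (algebraMap F _ x) = φ x) ∧
      ψ (IntermediateField.AdjoinSimple.gen F α) = β := by
  let _ := φ.toAlgebra
  refine ⟨((IntermediateField.algHomAdjoinIntegralEquiv F hα).symm
    ⟨β, (Polynomial.mem_aroots.mpr ⟨minpoly.ne_zero hα, hβ⟩)⟩ :
      IntermediateField.adjoin F {α} →ₐ[F] E').toRingHom, fun x => ?_, ?_⟩
  · exact AlgHom.commutes _ x
  · exact IntermediateField.algHomAdjoinIntegralEquiv_symm_apply_gen F hα _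

theorem exists_extension_of_transcendental {F E E' : Type*} [Field F] [Field E] [Field E']
    [Algebra F E] (φ : F →+* E') {α : E} {β : E'} (hα : Transcendental F α)
    (hβ : ∀ p : Polynomial F, p.eval₂ φ β = 0 → p = 0) :
    ∃ ψ : IntermediateField.adjoin F {α} →+* E', (∀ x, ψ (algebraMap F _ x) = φ x) ∧
      ψ (IntermediateField.AdjoinSimple.gen F α) = β := by
  let _ := φ.toAlgebra
  have hβ' : Transcendental F β := by
    rw [transcendental_iff]
    exact hβ
  let e₁ := RatFunc.algEquivOfTranscendental α hα
  let e₂ := RatFunc.algEquivOfTranscendental β hβ'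
  refine ⟨((IntermediateField.val _).comp (e₁.symm.trans e₂).toAlgHom).toRingHom,
    fun x => ?_, ?_⟩
  · exact AlgHom.commutes ((IntermediateField.val _).comp (e₁.symm.trans e₂).toAlgHom) x
  · have h : e₁.symm (IntermediateField.AdjoinSimple.gen F α) = RatFunc.X := by
      rw [AlgEquiv.symm_apply_eq]
      exact Subtype.ext (RatFunc.algEquivOfTranscendental_X α hα).symm
    change ((e₂ (e₁.symm _) : IntermediateField.adjoin F {β}) : E') = β
    rw [h]
    exact RatFunc.algEquivOfTranscendental_X β hβ'

theorem exists_fg_range_mem {k K K' : Type*} [Field k] [Field K] [Field K'] [Algebra k K]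
    [Algebra k K'] {F : IntermediateField k K} (hF : F.FG) (φ : F →ₐ[k] K') :
    ∃ M : IntermediateField k K', M.FG ∧ ∀ x, φ x ∈ M := by
  obtain ⟨s, rfl⟩ := hF
  refine ⟨IntermediateField.adjoin k (φ '' (Subtype.val ⁻¹' (s : Set K))),
    IntermediateField.fg_adjoin_of_finite
      ((s.finite_toSet.preimage Subtype.val_injective.injOn).image _), ?_⟩
  rintro ⟨x, hx⟩
  induction hx using IntermediateField.adjoin_induction with
  | mem x hx => exact IntermediateField.subset_adjoin _ _ ⟨_, hx, rfl⟩
  | algebraMap c =>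
    have := φ.commutes c
    change φ (algebraMap k _ c) ∈ _
    rw [this]
    exact algebraMap_mem _ c
  | add x y hx hy h1 h2 =>
    have := add_mem h1 h2
    rwa [← map_add] at this
  | inv x hx h =>
    have := inv_mem h
    rwa [← map_inv₀] at this
  | mul x y hx hy h1 h2 =>
    have := mul_mem h1 h2
    rwa [← map_mul] at this

end Extension

/-! ### Convergent models of finitely generated fields -/

section Models

variable {k : Type*} [NontriviallyNormedField k]

/-- Take z convergent and transcendental over a finitely generated M containing h and φ(F), and a in
k(h) near α. Then a + hⁿz is near α for large n, and it is transcendental over M because a and hⁿ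
lie in M. -/
theorem exists_convergent_transcendental_near [CharZero k] {F : IntermediateField k k⸨X⸩}
    (hF : F.FG) (φ : F →ₐ[k] k⸨X⸩) {α : k⸨X⸩} {W : Set k⸨X⸩} (hW : W ∈ 𝓝 α) :
    ∃ β ∈ W, IsConvergent β ∧ ∀ p : Polynomial F, p.eval₂ (φ : F →+* k⸨X⸩) β = 0 → p = 0 := by
  obtain ⟨M₀, hM₀, hφ⟩ := exists_fg_range_mem hF φ
  set M := M₀ ⊔ rationalFunctions k with hM
  have hMfg : M.FG := IntermediateField.fg_sup hM₀
    (IntermediateField.fg_adjoin_of_finite (Set.finite_singleton _))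
  have hSM : (HahnSeries.single 1 1 : k⸨X⸩) ∈ M :=
    (le_sup_right : _ ≤ M) (IntermediateField.mem_adjoin_simple_self k _)
  obtain ⟨z, hz, hzM⟩ := exists_convergent_transcendental M hMfg
  obtain ⟨U, hUW, hU, hαU⟩ := mem_nhds_iff.mp hW
  obtain ⟨a, haU, ha⟩ := dense_rationalFunctions.exists_mem_open hU ⟨α, hαU⟩
  have hlim : Tendsto (fun n : ℕ => a + (HahnSeries.single 1 1 : k⸨X⸩) ^ n * z) atTop (𝓝 a) := by
    simpa using (tendsto_X_pow.mul_const z).const_add a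
  obtain ⟨n, hn⟩ := (hlim.eventually (hU.mem_nhds ha)).exists
  refine ⟨_, hUW hn, (rationalFunctions_le_convergentSeries haU).add
    (IsConvergent.mul (mem_convergentSeries.mp (pow_mem
      (mem_convergentSeries.mpr (isConvergent_single 1 1)) n)) hz), fun p hp => ?_⟩
  let f : F →+* M := (φ : F →+* k⸨X⸩).codRestrict M fun x => (le_sup_left : M₀ ≤ M) (hφ x)
  have h1 : Polynomial.aeval (a + (HahnSeries.single 1 1 : k⸨X⸩) ^ n * z) (p.map f) = 0 := by
    rw [Polynomial.aeval_def, Polynomial.eval₂_map]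
    exact hp
  have h2 : Transcendental M (a + (HahnSeries.single 1 1 : k⸨X⸩) ^ n * z) := by
    intro halg
    refine hzM ?_
    have h3 : IsAlgebraic M a := isAlgebraic_algebraMap (⟨a, (le_sup_right : _ ≤ M) haU⟩ : M)
    have h4 : IsAlgebraic M ((HahnSeries.single 1 1 : k⸨X⸩) ^ n)⁻¹ :=
      isAlgebraic_algebraMap (⟨_, inv_mem (pow_mem hSM n)⟩ : M)
    have h5 := h4.mul (halg.sub h3)
    rwa [add_sub_cancel_left, inv_mul_cancel_left₀ (pow_ne_zero _ (by simp))] at h5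
  have h3 := (transcendental_iff.mp h2) _ h1
  exact (Polynomial.map_eq_zero_iff f.injective).mp h3

/-- The inclusion of `F` in `k((h))` is a pointwise limit of embeddings over `k(h)` of `F` in the
field of convergent series. -/
def HasConvergentModels (F : IntermediateField k k⸨X⸩) : Prop :=
  ∀ U ∈ 𝓝 (fun x : F => (x : k⸨X⸩)), ∃ φ : F →ₐ[k] k⸨X⸩,
    (∀ x : F, (x : k⸨X⸩) = HahnSeries.single 1 1 → φ x = HahnSeries.single 1 1) ∧
    (∀ x, IsConvergent (φ x)) ∧ (fun x => φ x) ∈ U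

theorem hasConvergentModels_of_le_convergentSeries {F : IntermediateField k k⸨X⸩}
    (hF : F ≤ convergentSeries k) : HasConvergentModels F := fun _ hU =>
  ⟨F.val, fun _ hx => hx, fun x => hF x.2, mem_of_mem_nhds hU⟩

/-- The value at `b` of a polynomial whose coefficients are moved by `f`. -/
def evalAlong {F K : Type*} [Semiring F] [Semiring K] (p : Polynomial F) (q : (F → K) × K) : K :=
  ∑ i ∈ Finset.range (p.natDegree + 1), q.1 (p.coeff i) * q.2 ^ i

theorem continuous_evalAlong {F K : Type*} [Semiring F] [Semiring K] [TopologicalSpace K]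
    [IsTopologicalSemiring K] (p : Polynomial F) :
    Continuous (evalAlong (K := K) p) := by
  unfold evalAlong
  fun_prop

theorem evalAlong_ringHom {F K : Type*} [Semiring F] [Semiring K] (p : Polynomial F)
    (f : F →+* K) (b : K) : evalAlong p (f, b) = p.eval₂ f b :=
  (Polynomial.eval₂_eq_sum_range f b).symm

theorem exists_eq_div_of_mem_adjoin {F E : Type*} [Field F] [Field E] [Algebra F E] {α : E}
    (x : IntermediateField.adjoin F {α}) : ∃ r s : Polynomial F,
      Polynomial.aeval α s ≠ 0 ∧ (x : E) = Polynomial.aeval α r / Polynomial.aeval α s := by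
  obtain ⟨r, s, h⟩ := (IntermediateField.mem_adjoin_simple_iff F (x : E)).mp x.2
  by_cases hs : Polynomial.aeval α s = 0
  -- With division by zero the element is 0; writing it as 0/1 keeps every denominator nonzero, as
  -- the continuity argument requires.
  · exact ⟨0, 1, by simp, by simp [h, hs]⟩
  · exact ⟨r, s, hs, h⟩

/-- With fixed fractions r(α)/s(α) for all elements of F(α), the map Φ that evaluates them at an
arbitrary (f, b) is continuous at (inclusion, α). An extension ψ of φ with ψ(α) = β is Φ(φ, β), so
its closeness to the inclusion and the convergence of its values follow from those of φ and β. -/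
theorem HasConvergentModels.adjoin_simple [CharZero k] {F : IntermediateField k k⸨X⸩}
    (hF : HasConvergentModels F) (hfg : F.FG) (hX : HahnSeries.single 1 1 ∈ F) (α : k⸨X⸩) :
    HasConvergentModels ((IntermediateField.adjoin F {α}).restrictScalars k) := by
  intro U hU
  choose r s hs hrs using fun x : IntermediateField.adjoin F {α} => exists_eq_div_of_mem_adjoin x
  let Φ : (F → k⸨X⸩) × k⸨X⸩ → IntermediateField.adjoin F {α} → k⸨X⸩ := fun q x =>
    evalAlong (r x) q / evalAlong (s x) q
  have hev : ∀ p : Polynomial F, evalAlong p ((fun x : F => (x : k⸨X⸩)), α) =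
      Polynomial.aeval α p := fun p => evalAlong_ringHom p (algebraMap F k⸨X⸩) α
  have hΦ : ContinuousAt Φ ((fun x : F => (x : k⸨X⸩)), α) := by
    rw [continuousAt_pi]
    intro x
    refine (continuous_evalAlong _).continuousAt.div (continuous_evalAlong _).continuousAt ?_
    rw [hev]
    exact hs x
  have hΦ0 : Φ ((fun x : F => (x : k⸨X⸩)), α) = Subtype.val := by
    funext x
    simp only [Φ, hev]
    exact (hrs x).symm
  have hU' : ∀ᶠ q in 𝓝 ((fun x : F => (x : k⸨X⸩)), α), Φ q ∈ U := by
    refine hΦ ?_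
    rw [hΦ0]
    exact hU
  rw [nhds_prod_eq] at hU'
  obtain ⟨V, hV, W, hW, hVW⟩ := Filter.mem_prod_iff.mp hU'
  suffices hmain : ∃ φ : F →ₐ[k] k⸨X⸩,
      (∀ x : F, (x : k⸨X⸩) = HahnSeries.single 1 1 → φ x = HahnSeries.single 1 1) ∧
      (∀ x, IsConvergent (φ x)) ∧ (fun x => φ x) ∈ V ∧ ∃ β ∈ W, IsConvergent β ∧
      ∃ ψ : IntermediateField.adjoin F {α} →+* k⸨X⸩, (∀ x, ψ (algebraMap F _ x) = φ x) ∧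
        ψ (IntermediateField.AdjoinSimple.gen F α) = β by
    obtain ⟨φ, hφX, hφc, hφV, β, hβW, hβ, ψ, hψ, hψβ⟩ := hmain
    have hψp : ∀ p : Polynomial F, evalAlong p ((fun x => φ x), β) =
        ψ (Polynomial.aeval (IntermediateField.AdjoinSimple.gen F α) p) := by
      intro p
      rw [Polynomial.aeval_def, Polynomial.hom_eval₂, hψβ]
      have : ψ.comp (algebraMap F (IntermediateField.adjoin F {α})) = (φ : F →+* k⸨X⸩) :=
        RingHom.ext hψ
      rw [this]
      exact evalAlong_ringHom p (φ : F →+* k⸨X⸩) β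
    have hψΦ : (fun x => ψ x) = Φ ((fun x => φ x), β) := by
      funext x
      simp only [Φ, hψp]
      rw [← map_div₀]
      congr 1
      apply Subtype.ext
      rw [hrs x]
      simp
    have hconv : ∀ p : Polynomial F, evalAlong p ((fun x => φ x), β) ∈ convergentSeries k :=
      fun p => sum_mem fun i _ => mul_mem (hφc _) (pow_mem (mem_convergentSeries.mpr hβ) _)
    refine ⟨{ ψ with commutes' := fun c => ?_ }, fun x hx => ?_, fun x => ?_, ?_⟩
    · exact (hψ (algebraMap k F c)).trans (φ.commutes c)
    · have hx' : x = algebraMap F (IntermediateField.adjoin F {α}) ⟨_, hX⟩ := Subtype.ext hx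
      change ψ x = _
      rw [hx', hψ]
      exact hφX _ rfl
    · change ψ x ∈ convergentSeries k
      rw [congrFun hψΦ x]
      exact div_mem (hconv _) (hconv _)
    · change (fun x => ψ x) ∈ U
      rw [hψΦ]
      exact hVW (Set.mk_mem_prod hφV hβW)
  by_cases hα : IsAlgebraic F α
  · have hint : IsIntegral F α := hα.isIntegral
    set P := minpoly F α with hP
    let c : (F → k⸨X⸩) → ℕ → k⸨X⸩ := fun f i => f (P.coeff i)
    have hc : Continuous c := by fun_prop
    have hpoly : ∀ f : F →+* k⸨X⸩, polyOf (P.natDegree + 1) (c f) = P.map f := by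
      intro f
      rw [Polynomial.as_sum_range_C_mul_X_pow' (p := P.map f) (n := P.natDegree + 1)
        (Nat.lt_succ_of_le Polynomial.natDegree_map_le)]
      simp [polyOf, c]
    have h0 : (polyOf (P.natDegree + 1) (c fun x => (x : k⸨X⸩))).eval α = 0 := by
      have := hpoly (algebraMap F k⸨X⸩)
      change (polyOf (P.natDegree + 1) (c (algebraMap F k⸨X⸩))).eval α = 0
      rw [this, Polynomial.eval_map]
      exact minpoly.aeval F α
    have h1 : (polyOf (P.natDegree + 1) (c fun x => (x : k⸨X⸩))).derivative.eval α ≠ 0 := by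
      have := hpoly (algebraMap F k⸨X⸩)
      change (polyOf (P.natDegree + 1) (c (algebraMap F k⸨X⸩))).derivative.eval α ≠ 0
      rw [this, Polynomial.derivative_map, Polynomial.eval_map]
      have : CharZero F := charZero_of_injective_algebraMap (algebraMap k F).injective
      exact (minpoly.irreducible hint).separable.aeval_derivative_ne_zero (minpoly.aeval F α)
    -- The condition on the coefficients of the minimal polynomial is pulled back to a neighbourhood
    -- of the inclusion of F, so that one φ satisfies it and also lies in V.
    have hev' := hc.continuousAt.eventually (exists_convergent_root_near h0 h1 hW)
    obtain ⟨φ, hφX, hφc, hφV, hφ⟩ := hF _ (inter_mem hV hev')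
    obtain ⟨β, hβW, hβ, hroot⟩ := hφ fun j => hφc _
    refine ⟨φ, hφX, hφc, hφV, β, hβW, hβ, exists_extension_of_root (φ : F →+* k⸨X⸩) hint ?_⟩
    have := hpoly (φ : F →+* k⸨X⸩)
    rw [← Polynomial.eval_map, ← this]
    exact hroot
  · obtain ⟨φ, hφX, hφc, hφV⟩ := hF V hV
    obtain ⟨β, hβW, hβ, htr⟩ := exists_convergent_transcendental_near hfg φ hW
    exact ⟨φ, hφX, hφc, hφV, β, hβW, hβ,
      exists_extension_of_transcendental (φ : F →+* k⸨X⸩) hα htr⟩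

theorem hasConvergentModels_adjoin_finset [CharZero k] (s : Finset k⸨X⸩) :
    HasConvergentModels (IntermediateField.adjoin k ({HahnSeries.single 1 1} ∪ (s : Set k⸨X⸩))) := by
  classical
  induction s using Finset.induction_on with
  | empty =>
    refine hasConvergentModels_of_le_convergentSeries ?_
    rw [Finset.coe_empty, Set.union_empty]
    exact rationalFunctions_le_convergentSeries
  | insert α s _ ih =>
    have h := ih.adjoin_simple (IntermediateField.fg_adjoin_of_finite
      ((Set.finite_singleton _).union s.finite_toSet))
      (IntermediateField.subset_adjoin _ _ (Or.inl rfl)) α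
    rw [IntermediateField.adjoin_adjoin_left, Set.union_assoc] at h
    rwa [Finset.coe_insert, Set.insert_eq, Set.union_comm {α}]

theorem hasConvergentModels_of_fg [CharZero k] {L : IntermediateField k k⸨X⸩}
    (hL : rationalFunctions k ≤ L) (hfg : L.FG) : HasConvergentModels L := by
  obtain ⟨s, rfl⟩ := hfg
  have h := hasConvergentModels_adjoin_finset s
  rwa [IntermediateField.adjoin_union, ← rationalFunctions, sup_eq_right.mpr hL] at h

theorem HasConvergentModels.exists_congrMod {F : IntermediateField k k⸨X⸩}
    (hF : HasConvergentModels F) (hX : HahnSeries.single 1 1 ∈ F) {t : ℕ} (a : Fin t → F) (m : ℕ) :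
    ∃ φ : F →ₐ[k] k⸨X⸩, φ ⟨_, hX⟩ = HahnSeries.single 1 1 ∧ (∀ x, IsConvergent (φ x)) ∧
      ∀ i, CongrMod m (a i : k⸨X⸩) (φ (a i)) := by
  have hU : {f : F → k⸨X⸩ | ∀ i, CongrMod m (f (a i)) (a i : k⸨X⸩)} ∈
      𝓝 (fun x : F => (x : k⸨X⸩)) := by
    have : ∀ i, ∀ᶠ f : F → k⸨X⸩ in 𝓝 (fun x : F => (x : k⸨X⸩)),
        CongrMod m (f (a i)) (a i : k⸨X⸩) := fun i =>
      (continuous_apply (a i)).continuousAt.eventually (setOf_congrMod_mem_nhds m (a i : k⸨X⸩))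
    exact eventually_all.mpr this
  obtain ⟨φ, h1, h2, h3⟩ := hF _ hU
  exact ⟨φ, h1 _ rfl, h2, fun i => (h3 i).symm⟩

theorem map_eq_of_mem_rationalFunctions {F : IntermediateField k k⸨X⸩} (φ : F →ₐ[k] k⸨X⸩)
    (hX : HahnSeries.single 1 1 ∈ F) (hφ : φ ⟨_, hX⟩ = HahnSeries.single 1 1) (x : F)
    (hx : (x : k⸨X⸩) ∈ rationalFunctions k) : φ x = x := by
  obtain ⟨r, s, h⟩ := (IntermediateField.mem_adjoin_simple_iff k (x : k⸨X⸩)).mp hx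
  have hx' : x = Polynomial.aeval (⟨_, hX⟩ : F) r / Polynomial.aeval (⟨_, hX⟩ : F) s := by
    apply Subtype.ext
    change (x : k⸨X⸩) = F.val (_ / _)
    rw [h, map_div₀, ← Polynomial.aeval_algHom_apply, ← Polynomial.aeval_algHom_apply]
    rfl
  rw [hx', map_div₀, ← Polynomial.aeval_algHom_apply, ← Polynomial.aeval_algHom_apply, hφ, ← h, ← hx']

theorem exists_convergent_model [CharZero k] (L : IntermediateField k k⸨X⸩)
    (hL : rationalFunctions k ≤ L) (hfg : L.FG) (t : ℕ) (a : Fin t → L) (m : ℕ) :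
    ∃ (L' : IntermediateField k k⸨X⸩) (φ : L ≃+* L'),
      rationalFunctions k ≤ L' ∧ IsConvergentSubfield L' ∧ IsOverRationalFunctions φ ∧
        ∀ i, CongrMod m (a i : k⸨X⸩) (φ (a i) : k⸨X⸩) := by
  have hX : HahnSeries.single 1 1 ∈ L := hL (IntermediateField.mem_adjoin_simple_self k _)
  obtain ⟨φ, hφX, hφc, hφ⟩ := (hasConvergentModels_of_fg hL hfg).exists_congrMod hX a m
  refine ⟨φ.fieldRange, (AlgEquiv.ofInjectiveField φ).toRingEquiv, ?_, ?_, ?_, hφ⟩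
  · rw [rationalFunctions, IntermediateField.adjoin_simple_le_iff]
    exact ⟨_, hφX⟩
  · rintro _ ⟨x, rfl⟩
    exact hφc x
  · exact fun x hx => map_eq_of_mem_rationalFunctions φ hX hφX x hx

end Models

/-! ### Even and odd parts -/

section Parity

variable {k : Type*} [Field k]

theorem eps_coeff (f : k⸨X⸩) (n : ℤ) : (eps k f).coeff n = f.coeff n * (-1) ^ n := by
  simp [eps, twist, twistFun]

variable (k) in
/-- The substitution `f(h) ↦ f(h²)`. -/
def substSq : k⸨X⸩ →+* k⸨X⸩ :=
  HahnSeries.embDomainRingHom (AddMonoidHom.mulLeft (2 : ℤ))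
    (fun a b h => by simpa using h) (fun a b => by simp)

theorem substSq_coeff_even (f : k⸨X⸩) (n : ℤ) : (substSq k f).coeff (2 * n) = f.coeff n :=
  HahnSeries.embDomain_mk_coeff _ _

theorem substSq_coeff_odd (f : k⸨X⸩) (n : ℤ) : (substSq k f).coeff (2 * n + 1) = 0 := by
  refine HahnSeries.embDomain_of_notMem_range ?_
  rintro ⟨m, hm⟩
  have : 2 * m = 2 * n + 1 := hm
  omega

theorem substSq_algebraMap (c : k) : substSq k (algebraMap k k⸨X⸩ c) = algebraMap k k⸨X⸩ c := by
  rw [LaurentSeries.algebraMap_apply]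
  exact HahnSeries.embDomainRingHom_C

/-- The series `∑ₙ f₂ₙ₊ᵣ hⁿ`. -/
def parityPart (r : ℤ) (f : k⸨X⸩) : k⸨X⸩ :=
  HahnSeries.ofSuppBddBelow (fun n => f.coeff (2 * n + r)) <| by
    refine ⟨min (f.order - r) 0, fun n hn => ?_⟩
    by_contra h
    exact hn (HahnSeries.coeff_eq_zero_of_lt_order (by omega))

theorem parityPart_coeff (r : ℤ) (f : k⸨X⸩) (n : ℤ) :
    (parityPart r f).coeff n = f.coeff (2 * n + r) := by
  rfl

theorem ext_parity {f g : k⸨X⸩} (h0 : ∀ n, f.coeff (2 * n) = g.coeff (2 * n))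
    (h1 : ∀ n, f.coeff (2 * n + 1) = g.coeff (2 * n + 1)) : f = g := by
  ext n
  rcases Int.even_or_odd' n with ⟨m, rfl | rfl⟩
  · exact h0 m
  · exact h1 m

/-- The series `a(h²) + h b(h²)`. -/
def ofParts (a b : k⸨X⸩) : k⸨X⸩ := substSq k a + HahnSeries.single 1 1 * substSq k b

theorem ofParts_coeff_even (a b : k⸨X⸩) (n : ℤ) : (ofParts a b).coeff (2 * n) = a.coeff n := by
  rw [ofParts, HahnSeries.coeff_add, substSq_coeff_even, HahnSeries.coeff_single_mul,
    show 2 * n - 1 = 2 * (n - 1) + 1 by ring, substSq_coeff_odd]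
  simp

theorem ofParts_coeff_odd (a b : k⸨X⸩) (n : ℤ) : (ofParts a b).coeff (2 * n + 1) = b.coeff n := by
  rw [ofParts, HahnSeries.coeff_add, substSq_coeff_odd, HahnSeries.coeff_single_mul,
    show 2 * n + 1 - 1 = 2 * n by ring, substSq_coeff_even]
  simp

theorem ofParts_parityPart (f : k⸨X⸩) : ofParts (parityPart 0 f) (parityPart 1 f) = f :=
  ext_parity (fun n => by rw [ofParts_coeff_even, parityPart_coeff, add_zero])
    (fun n => by rw [ofParts_coeff_odd, parityPart_coeff])

theorem parityPart_zero_ofParts (a b : k⸨X⸩) : parityPart 0 (ofParts a b) = a := by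
  ext n
  rw [parityPart_coeff, add_zero, ofParts_coeff_even]

theorem parityPart_one_ofParts (a b : k⸨X⸩) : parityPart 1 (ofParts a b) = b := by
  ext n
  rw [parityPart_coeff, ofParts_coeff_odd]

theorem substSq_X : substSq k (HahnSeries.single 1 1) = HahnSeries.single 1 1 ^ 2 := by
  rw [HahnSeries.single_pow, one_pow]
  exact HahnSeries.embDomain_single

theorem ofParts_add (a b c d : k⸨X⸩) : ofParts a b + ofParts c d = ofParts (a + c) (b + d) := by
  simp only [ofParts, map_add]
  ring

/-- Pairs multiply like a + b√h: up to the substitution h ↦ h², K is a quadratic extension of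
itself, with ε as its conjugation. -/
theorem ofParts_mul (a b c d : k⸨X⸩) : ofParts a b * ofParts c d =
    ofParts (a * c + HahnSeries.single 1 1 * (b * d)) (a * d + b * c) := by
  simp only [ofParts, map_add, map_mul, substSq_X]
  ring

theorem ofParts_algebraMap (c : k) :
    ofParts (algebraMap k k⸨X⸩ c) 0 = algebraMap k k⸨X⸩ c := by
  rw [ofParts, substSq_algebraMap, map_zero, mul_zero, add_zero]

theorem ofParts_X : ofParts 0 1 = (HahnSeries.single 1 1 : k⸨X⸩) := by
  simp [ofParts]

theorem eps_ofParts (a b : k⸨X⸩) : eps k (ofParts a b) = ofParts a (-b) := by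
  refine ext_parity (fun n => ?_) (fun n => ?_)
  · rw [eps_coeff, ofParts_coeff_even, ofParts_coeff_even, Even.neg_one_zpow (even_two_mul n),
      mul_one]
  · rw [eps_coeff, ofParts_coeff_odd, ofParts_coeff_odd,
      Odd.neg_one_zpow (odd_two_mul_add_one n), HahnSeries.coeff_neg, mul_neg_one]

theorem ofParts_inv (a b : k⸨X⸩) : (ofParts a b)⁻¹ =
    ofParts (a / (a ^ 2 - HahnSeries.single 1 1 * b ^ 2))
      (-b / (a ^ 2 - HahnSeries.single 1 1 * b ^ 2)) := by
  rcases eq_or_ne (ofParts a b) 0 with h0 | h0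
  · have ha : a = 0 := by rw [← parityPart_zero_ofParts a b, h0]; ext n; simp [parityPart_coeff]
    have hb : b = 0 := by rw [← parityPart_one_ofParts a b, h0]; ext n; simp [parityPart_coeff]
    subst ha hb
    simp [ofParts]
  -- The denominator is the norm x ε(x), read back through h ↦ h²; hence it is nonzero for x ≠ 0.
  · have hN : substSq k (a ^ 2 - HahnSeries.single 1 1 * b ^ 2) =
        ofParts a b * eps k (ofParts a b) := by
      rw [eps_ofParts, ofParts_mul, ofParts]
      simp only [map_add, map_sub, map_mul, map_neg, map_pow]
      ring
    have hN0 : a ^ 2 - HahnSeries.single 1 1 * b ^ 2 ≠ 0 := by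
      intro h
      rw [h, map_zero] at hN
      exact mul_ne_zero h0 ((map_ne_zero _).mpr h0) hN.symm
    refine inv_eq_of_mul_eq_one_right ?_
    rw [ofParts_mul]
    have h1 : a * (a / (a ^ 2 - HahnSeries.single 1 1 * b ^ 2)) + HahnSeries.single 1 1 *
        (b * (-b / (a ^ 2 - HahnSeries.single 1 1 * b ^ 2))) = 1 := by
      field_simp
      ring
    have h2 : a * (-b / (a ^ 2 - HahnSeries.single 1 1 * b ^ 2)) +
        b * (a / (a ^ 2 - HahnSeries.single 1 1 * b ^ 2)) = 0 := by
      ring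
    rw [h1, h2]
    simp [ofParts]

/-- The field generated by `h` and the even and odd parts of the elements of `S`. -/
def parityField (S : Set k⸨X⸩) : IntermediateField k k⸨X⸩ :=
  IntermediateField.adjoin k ({HahnSeries.single 1 1} ∪ (parityPart 0 '' S ∪ parityPart 1 '' S))

/-- Pairs with both entries in a field containing h are closed under the field operations, by the
formulas for products and inverses. Hence the parts of the generators, together with h, account for
the parts of all elements. -/
theorem exists_ofParts_of_mem_adjoin {S : Set k⸨X⸩} {f : k⸨X⸩}
    (hf : f ∈ IntermediateField.adjoin k S) :
    ∃ a ∈ parityField S, ∃ b ∈ parityField S, ofParts a b = f := by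
  have hX : HahnSeries.single 1 1 ∈ parityField S :=
    IntermediateField.subset_adjoin _ _ (Or.inl rfl)
  induction hf using IntermediateField.adjoin_induction with
  | mem x hx =>
    exact ⟨_, IntermediateField.subset_adjoin _ _ (Or.inr (Or.inl ⟨x, hx, rfl⟩)), _,
      IntermediateField.subset_adjoin _ _ (Or.inr (Or.inr ⟨x, hx, rfl⟩)), ofParts_parityPart x⟩
  | algebraMap c => exact ⟨_, algebraMap_mem _ c, 0, zero_mem _, ofParts_algebraMap c⟩
  | add x y _ _ h1 h2 =>
    obtain ⟨a, ha, b, hb, rfl⟩ := h1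
    obtain ⟨c, hc, d, hd, rfl⟩ := h2
    exact ⟨_, add_mem ha hc, _, add_mem hb hd, (ofParts_add _ _ _ _).symm⟩
  | inv x _ h =>
    obtain ⟨a, ha, b, hb, rfl⟩ := h
    have hN := sub_mem (pow_mem ha 2) (mul_mem hX (pow_mem hb 2))
    exact ⟨_, div_mem ha hN, _, div_mem (neg_mem hb) hN, (ofParts_inv a b).symm⟩
  | mul x y _ _ h1 h2 =>
    obtain ⟨a, ha, b, hb, rfl⟩ := h1
    obtain ⟨c, hc, d, hd, rfl⟩ := h2
    exact ⟨_, add_mem (mul_mem ha hc) (mul_mem hX (mul_mem hb hd)), _,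
      add_mem (mul_mem ha hd) (mul_mem hb hc), (ofParts_mul _ _ _ _).symm⟩

theorem parityPart_mem {S : Set k⸨X⸩} {f : k⸨X⸩} (hf : f ∈ IntermediateField.adjoin k S) :
    parityPart 0 f ∈ parityField S ∧ parityPart 1 f ∈ parityField S := by
  obtain ⟨a, ha, b, hb, rfl⟩ := exists_ofParts_of_mem_adjoin hf
  rw [parityPart_zero_ofParts, parityPart_one_ofParts]
  exact ⟨ha, hb⟩

/-- The extension to `L` of an embedding `φ` of the field of the even and odd parts,
`a(h²) + h b(h²) ↦ (φ a)(h²) + h (φ b)(h²)`. -/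
def parityExtend {M L : IntermediateField k k⸨X⸩} (φ : M →ₐ[k] k⸨X⸩)
    (hX : HahnSeries.single 1 1 ∈ M) (hφ : φ ⟨_, hX⟩ = HahnSeries.single 1 1)
    (h : ∀ f ∈ L, parityPart 0 f ∈ M ∧ parityPart 1 f ∈ M) : L →ₐ[k] k⸨X⸩ :=
  -- The parts are unique, so the value may be computed from any pair that represents f; each ring
  -- law then becomes a law for pairs.
  have key : ∀ (f : L) (a b : M), (f : k⸨X⸩) = ofParts (a : k⸨X⸩) b →
      ofParts (φ ⟨_, (h f f.2).1⟩) (φ ⟨_, (h f f.2).2⟩) = ofParts (φ a) (φ b) := by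
    intro f a b hf
    congr 2
    · apply Subtype.ext
      change parityPart 0 (f : k⸨X⸩) = a
      rw [hf, parityPart_zero_ofParts]
    · apply Subtype.ext
      change parityPart 1 (f : k⸨X⸩) = b
      rw [hf, parityPart_one_ofParts]
  have hadd : ∀ x y, φ (x + y) = φ x + φ y := φ.toRingHom.map_add
  have hmul : ∀ x y, φ (x * y) = φ x * φ y := φ.toRingHom.map_mul
  { toFun f := ofParts (φ ⟨_, (h f f.2).1⟩) (φ ⟨_, (h f f.2).2⟩)
    map_one' := by
      refine (key 1 1 0 ?_).trans ?_ <;> simp [ofParts]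
    map_zero' := by
      refine (key 0 0 0 ?_).trans ?_ <;> simp [ofParts]
    map_add' f g := by
      refine (key (f + g) (⟨_, (h f f.2).1⟩ + ⟨_, (h g g.2).1⟩)
        (⟨_, (h f f.2).2⟩ + ⟨_, (h g g.2).2⟩) ?_).trans ?_
      · rw [IntermediateField.coe_add, IntermediateField.coe_add, IntermediateField.coe_add,
          ← ofParts_add, ofParts_parityPart, ofParts_parityPart]
      · rw [hadd, hadd, ofParts_add]
    map_mul' f g := by
      refine (key (f * g) (⟨_, (h f f.2).1⟩ * ⟨_, (h g g.2).1⟩ + ⟨_, hX⟩ *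
          (⟨_, (h f f.2).2⟩ * ⟨_, (h g g.2).2⟩))
        (⟨_, (h f f.2).1⟩ * ⟨_, (h g g.2).2⟩ + ⟨_, (h f f.2).2⟩ * ⟨_, (h g g.2).1⟩) ?_).trans ?_
      · simp only [IntermediateField.coe_add, IntermediateField.coe_mul]
        rw [← ofParts_mul, ofParts_parityPart, ofParts_parityPart]
      · refine (congrArg₂ ofParts ?_ ?_).trans (ofParts_mul _ _ _ _).symm
        -- The product law contains h, and this is where φ(h) = h enters.
        · rw [hadd, hmul, hmul, hmul, hφ]
        · rw [hadd, hmul, hmul]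
    commutes' c := by
      refine (key (algebraMap k L c) (algebraMap k M c) 0 ?_).trans ?_
      · exact (ofParts_algebraMap c).symm
      · exact (congrArg₂ ofParts (φ.commutes c) (map_zero φ)).trans (ofParts_algebraMap c) }

theorem parityExtend_apply {M L : IntermediateField k k⸨X⸩} (φ : M →ₐ[k] k⸨X⸩)
    (hX : HahnSeries.single 1 1 ∈ M) (hφ : φ ⟨_, hX⟩ = HahnSeries.single 1 1)
    (h : ∀ f ∈ L, parityPart 0 f ∈ M ∧ parityPart 1 f ∈ M) (f : L) (a b : M)
    (hf : (f : k⸨X⸩) = ofParts (a : k⸨X⸩) b) :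
    parityExtend φ hX hφ h f = ofParts (φ a) (φ b) := by
  change ofParts (φ ⟨_, (h f f.2).1⟩) (φ ⟨_, (h f f.2).2⟩) = _
  congr 2
  · apply Subtype.ext
    change parityPart 0 (f : k⸨X⸩) = a
    rw [hf, parityPart_zero_ofParts]
  · apply Subtype.ext
    change parityPart 1 (f : k⸨X⸩) = b
    rw [hf, parityPart_one_ofParts]

theorem congrMod_iff_coeff {m : ℕ} {f g : k⸨X⸩} :
    CongrMod m f g ↔ ∀ n : ℤ, n < m → f.coeff n = g.coeff n := by
  rw [congrMod_iff_valuation, LaurentSeries.valuation_le_iff_coeff_lt_eq_zero]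
  simp [sub_eq_zero]

theorem CongrMod.ofParts {m : ℕ} {a b c d : k⸨X⸩} (h : CongrMod m a c) (h' : CongrMod m b d) :
    CongrMod m (ofParts a b) (ofParts c d) := by
  rw [congrMod_iff_coeff] at h h' ⊢
  intro n hn
  rcases Int.even_or_odd' n with ⟨j, rfl | rfl⟩
  · rw [ofParts_coeff_even, ofParts_coeff_even]
    -- From 2j < m follows j < m, also for negative j because m ≥ 0.
    exact h j (by omega)
  · rw [ofParts_coeff_odd, ofParts_coeff_odd]
    exact h' j (by omega)

end Parity

/-! ### Convergent models compatible with ε -/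

section EquivariantModels

variable {k : Type*} [NontriviallyNormedField k]

theorem IsConvergent.substSq {f : k⸨X⸩} (hf : IsConvergent f) : IsConvergent (substSq k f) := by
  obtain ⟨r, hr, h⟩ := isConvergent_iff.mp hf
  refine isConvergent_iff.mpr ⟨√r, Real.sqrt_pos.mpr hr, ?_⟩
  have hinj : Function.Injective fun n : ℤ => 2 * n := fun a b hab => by simpa using hab
  refine (hinj.summable_iff fun n hn => ?_).mp ?_
  · rcases Int.even_or_odd' n with ⟨j, rfl | rfl⟩
    · exact absurd ⟨j, rfl⟩ hn
    · rw [substSq_coeff_odd, norm_zero, zero_mul]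
  · refine (summable_congr fun n => ?_).mp h
    change ‖f.coeff n‖ * r ^ n = ‖(FormalUnitarity.substSq k f).coeff (2 * n)‖ * √r ^ (2 * n)
    rw [substSq_coeff_even, zpow_mul, zpow_ofNat, Real.sq_sqrt hr.le]

theorem IsConvergent.ofParts {a b : k⸨X⸩} (ha : IsConvergent a) (hb : IsConvergent b) :
    IsConvergent (ofParts a b) :=
  ha.substSq.add ((isConvergent_single 1 1).mul hb.substSq)

theorem exists_equivariant_convergent_model [CharZero k] (L : IntermediateField k k⸨X⸩)
    (hL : rationalFunctions k ≤ L) (hfg : L.FG) (hε : EpsInvariant L) (t : ℕ) (a : Fin t → L)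
    (m : ℕ) :
    ∃ (L' : IntermediateField k k⸨X⸩) (Ω : L ≃+* L'),
      rationalFunctions k ≤ L' ∧ EpsInvariant L' ∧ IsConvergentSubfield L' ∧
        IsOverRationalFunctions Ω ∧ IsEpsEquivariant hε Ω ∧
        ∀ i, CongrMod m (a i : k⸨X⸩) (Ω (a i) : k⸨X⸩) := by
  obtain ⟨s, hs⟩ := hfg
  set M := parityField (s : Set k⸨X⸩) with hM
  have hMfg : M.FG := IntermediateField.fg_adjoin_of_finite ((Set.finite_singleton _).union
    ((s.finite_toSet.image _).union (s.finite_toSet.image _)))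
  have hX : HahnSeries.single 1 1 ∈ M := IntermediateField.subset_adjoin _ _ (Or.inl rfl)
  have hXL : HahnSeries.single 1 1 ∈ L := hL (IntermediateField.mem_adjoin_simple_self k _)
  have hpart : ∀ f ∈ L, parityPart 0 f ∈ M ∧ parityPart 1 f ∈ M := by
    rw [← hs]
    exact fun f => parityPart_mem
  have hrM : rationalFunctions k ≤ M := IntermediateField.adjoin_simple_le_iff.mpr hX
  -- The even and odd parts of all aᵢ are approximated at once, as a single list of length 2t.
  obtain ⟨φ, hφX, hφc, hφ⟩ := (hasConvergentModels_of_fg hrM hMfg).exists_congrMod hX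
    (Fin.append (fun i => (⟨_, (hpart _ (a i).2).1⟩ : M)) (fun i => ⟨_, (hpart _ (a i).2).2⟩)) m
  set ψ : L →ₐ[k] k⸨X⸩ := parityExtend φ hX hφX hpart with hψ
  have hψap : ∀ f : L, ψ f = ofParts (φ ⟨_, (hpart f f.2).1⟩) (φ ⟨_, (hpart f f.2).2⟩) :=
    fun f => rfl
  have hψX : ψ ⟨_, hXL⟩ = HahnSeries.single 1 1 := by
    rw [hψ, parityExtend_apply φ hX hφX hpart _ 0 1 (by simp [ofParts]), map_zero, map_one,
      ofParts_X]
  have hψε : ∀ f : L, eps k (ψ f) = ψ ⟨eps k f, hε f f.2⟩ := by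
    intro f
    rw [hψap f, eps_ofParts, hψ, parityExtend_apply φ hX hφX hpart ⟨eps k f, hε f f.2⟩
      ⟨_, (hpart f f.2).1⟩ (-⟨_, (hpart f f.2).2⟩), map_neg]
    change eps k f = ofParts (parityPart 0 f) (-parityPart 1 f)
    rw [← eps_ofParts, ofParts_parityPart]
  refine ⟨ψ.fieldRange, (AlgEquiv.ofInjectiveField ψ).toRingEquiv, ?_, ?_, ?_, ?_, hψε, ?_⟩
  · rw [rationalFunctions, IntermediateField.adjoin_simple_le_iff]
    exact ⟨_, hψX⟩
  · rintro _ ⟨x, rfl⟩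
    exact ⟨_, (hψε x).symm⟩
  · rintro _ ⟨x, rfl⟩
    exact (hφc _).ofParts (hφc _)
  · exact fun x hx => map_eq_of_mem_rationalFunctions ψ hXL hψX x hx
  · intro i
    have h0 := hφ (Fin.castAdd t i)
    have h1 := hφ (Fin.natAdd t i)
    rw [Fin.append_left] at h0
    rw [Fin.append_right] at h1
    have := h0.ofParts h1
    rwa [ofParts_parityPart] at this

end EquivariantModels

/-! ### Matrix coefficients and change of coefficients -/

section MatrixCoefficients

theorem mem_unitarySubgroup_iff {F : Type*} [Field F] {N : ℕ} {σ : F →+* F}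
    {x : Matrix.GeneralLinearGroup (Fin N) F} :
    x ∈ unitarySubgroup N σ ↔ ∀ i j, (x⁻¹).val i j = σ (x.val j i) := by
  change (x⁻¹).val = (x.val.map σ).transpose ↔ _
  rw [← Matrix.ext_iff]
  rfl

theorem mem_unitaryOver_iff {k : Type*} [Field k] {N : ℕ} {L : IntermediateField k k⸨X⸩}
    {x : Matrix.GeneralLinearGroup (Fin N) L} :
    x ∈ unitaryOver N L ↔ ∀ i j, ((x⁻¹).val i j : k⸨X⸩) = eps k (x.val j i : k⸨X⸩) := by
  rw [unitaryOver, Subgroup.mem_comap, mem_unitarySubgroup_iff]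
  rfl

theorem map_unitaryOver {k : Type*} [Field k] {N : ℕ} {L L' : IntermediateField k k⸨X⸩}
    (hL : EpsInvariant L) (Ω : L ≃+* L') (hΩ : IsEpsEquivariant hL Ω) :
    (unitaryOver N L).map (Matrix.GeneralLinearGroup.map (Ω : L →+* L')) = unitaryOver N L' := by
  have key : ∀ x : Matrix.GeneralLinearGroup (Fin N) L,
      Matrix.GeneralLinearGroup.map (Ω : L →+* L') x ∈ unitaryOver N L' ↔ x ∈ unitaryOver N L := by
    intro x
    rw [mem_unitaryOver_iff, mem_unitaryOver_iff]
    refine forall₂_congr fun i j => ?_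
    change (Ω ((x⁻¹).val i j) : k⸨X⸩) = eps k (Ω (x.val j i) : k⸨X⸩) ↔ _
    rw [hΩ, ← Subtype.ext_iff, Ω.injective.eq_iff, Subtype.ext_iff]
  ext y
  rw [Subgroup.mem_map]
  constructor
  · rintro ⟨x, hx, rfl⟩
    exact (key x).mpr hx
  · intro hy
    have h : Matrix.GeneralLinearGroup.map (Ω : L →+* L')
        (Matrix.GeneralLinearGroup.map (Ω.symm : L' →+* L) y) = y := by
      refine Units.ext (Matrix.ext fun i j => ?_)
      exact Ω.apply_symm_apply (y.val i j)
    refine ⟨_, (key _).mp ?_, h⟩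
    rw [h]
    exact hy

variable {G : Type*} [Group G] {N : ℕ}

/-- With generators of G as a monoid, entries arise by sums and products only. A subring thus
suffices, with no division by determinants. -/
theorem coefficients_mem_of_closure {K : Type*} [CommRing K]
    (R : G →* Matrix.GeneralLinearGroup (Fin N) K) (A : Subring K) {S : Set G}
    (hS : Submonoid.closure S = ⊤) (h : ∀ g ∈ S, ∀ i j, (R g).val i j ∈ A) (g : G) (i j : Fin N) :
    (R g).val i j ∈ A := by
  have hg : g ∈ Submonoid.closure S := hS ▸ Submonoid.mem_top g
  induction hg using Submonoid.closure_induction generalizing i j with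
  | mem g hg => exact h g hg i j
  | one =>
    rw [map_one, Units.val_one, Matrix.one_apply]
    split_ifs
    · exact one_mem _
    · exact zero_mem _
  | mul x y _ _ hx hy =>
    rw [map_mul, Units.val_mul, Matrix.mul_apply]
    exact sum_mem fun l _ => mul_mem (hx i l) (hy l j)

theorem exists_map_coefficients {K B : Type*} [CommRing K] [CommRing B]
    (R : G →* Matrix.GeneralLinearGroup (Fin N) K) (A : Subring K)
    (h : ∀ g i j, (R g).val i j ∈ A) (f : A →+* B) :
    ∃ R' : G →* Matrix.GeneralLinearGroup (Fin N) B,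
      ∀ g i j, (R' g).val i j = f ⟨(R g).val i j, h g i j⟩ := by
  let M : G →* Matrix (Fin N) (Fin N) B :=
    { toFun g := Matrix.of fun i j => f ⟨(R g).val i j, h g i j⟩
      map_one' := by
        ext i j
        rw [Matrix.of_apply, Matrix.one_apply]
        have : (⟨(R 1).val i j, h 1 i j⟩ : A) = if i = j then 1 else 0 := by
          apply Subtype.ext
          simp only [map_one, Units.val_one, Matrix.one_apply]
          split_ifs <;> rfl
        rw [this]
        split_ifs <;> simp
      map_mul' x y := by
        ext i j
        rw [Matrix.of_apply, Matrix.mul_apply]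
        have : (⟨(R (x * y)).val i j, h (x * y) i j⟩ : A) =
            ∑ l, ⟨(R x).val i l, h x i l⟩ * ⟨(R y).val l j, h y l j⟩ := by
          apply Subtype.ext
          rw [AddSubmonoidClass.coe_finsetSum]
          simp only [map_mul, Units.val_mul, Matrix.mul_apply, Subring.coe_mul]
        rw [this, map_sum]
        exact Finset.sum_congr rfl fun l _ => map_mul f _ _ }
  -- A monoid homomorphism from a group takes values in the units, so invertibility is automatic.
  exact ⟨M.toHomUnits, fun g i j => rfl⟩

end MatrixCoefficients

/-! ### The smallest ε-invariant coefficient field -/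

section CoefficientField

variable {k : Type*} [Field k]

/-- The automorphism `ε` as an algebra homomorphism. -/
def epsAlgHom (k : Type*) [Field k] : k⸨X⸩ →ₐ[k] k⸨X⸩ :=
  { eps k with
    commutes' := fun c => by
      change eps k _ = _
      rw [← ofParts_algebraMap, eps_ofParts, neg_zero] }

theorem eps_X : eps k (HahnSeries.single 1 1) = -HahnSeries.single 1 1 := by
  rw [← ofParts_X, eps_ofParts]
  simp [ofParts]

theorem exists_isLeast_epsInvariant {G : Type*} [Group G] [Group.FG G] {N : ℕ}
    (R : G →* Matrix.GeneralLinearGroup (Fin N) k⸨X⸩)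
    (hR : ∀ g, R g ∈ unitarySubgroup N (eps k)) :
    ∃ L : IntermediateField k k⸨X⸩, L.FG ∧
      IsLeast {M : IntermediateField k k⸨X⸩ |
        rationalFunctions k ≤ M ∧ EpsInvariant M ∧ ∀ g i j, (R g).val i j ∈ M} L := by
  obtain ⟨S, hS, hSfin⟩ := (Monoid.fg_iff).mp (Group.fg_iff_monoid_fg.mp ‹Group.FG G›)
  set C : Set k⸨X⸩ := ⋃ g ∈ S, Set.range fun p : Fin N × Fin N => (R g).val p.1 p.2 with hC
  have hCfin : C.Finite := hSfin.biUnion fun g _ => Set.finite_range _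
  set L := IntermediateField.adjoin k ({HahnSeries.single 1 1} ∪ C) with hL
  have hX : HahnSeries.single 1 1 ∈ L := IntermediateField.subset_adjoin _ _ (Or.inl rfl)
  have hmem : ∀ g i j, (R g).val i j ∈ L := by
    refine coefficients_mem_of_closure R L.toSubfield.toSubring hS fun g hg i j => ?_
    exact IntermediateField.subset_adjoin _ _ (Or.inr (Set.mem_biUnion hg ⟨(i, j), rfl⟩))
  have hεle : L ≤ L.comap (epsAlgHom k) := by
    rw [hL, IntermediateField.adjoin_le_iff, ← hL]
    rintro x (rfl | hx)
    · change eps k _ ∈ L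
      rw [eps_X]
      exact neg_mem hX
    · obtain ⟨g, hg, ⟨i, j⟩, rfl⟩ := Set.mem_iUnion₂.mp hx
      change eps k ((R g).val i j) ∈ L
      -- Unitarity rewrites ε of an entry of R(g) as an entry of R(g⁻¹), which already lies in L.
      rw [← mem_unitarySubgroup_iff.mp (hR g) j i, ← map_inv]
      exact hmem _ _ _
  refine ⟨L, IntermediateField.fg_adjoin_of_finite ((Set.finite_singleton _).union hCfin),
    ⟨IntermediateField.adjoin_simple_le_iff.mpr hX, fun x hx => hεle hx, hmem⟩, ?_⟩
  rintro M ⟨h1, -, h3⟩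
  rw [hL, IntermediateField.adjoin_le_iff]
  rintro x (rfl | hx)
  · exact h1 (IntermediateField.mem_adjoin_simple_self k _)
  · obtain ⟨g, hg, ⟨i, j⟩, rfl⟩ := Set.mem_iUnion₂.mp hx
    exact h3 g i j

end CoefficientField

/-! ### Evaluation of absolutely convergent Laurent series -/

section Evaluation

variable {k : Type*} [NormedField k]

variable (k) in
/-- The ring of the Laurent series that converge absolutely at radius `r`. -/
def summableSubring (r : ℝ) (hr : 0 < r) : Subring k⸨X⸩ where
  carrier := {f | SummableAt r f}
  mul_mem' := SummableAt.mul hr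
  one_mem' := summableAt_one r
  add_mem' := SummableAt.add hr
  zero_mem' := summableAt_zero r
  neg_mem' := SummableAt.neg

theorem SummableAt.summable_norm_coeff_mul_zpow {s : k} {f : k⸨X⸩} (hf : SummableAt ‖s‖ f) :
    Summable fun n : ℤ => ‖f.coeff n * s ^ n‖ := by
  simp only [norm_mul, norm_zpow]
  exact hf

theorem SummableAt.summable_coeff_mul_zpow [CompleteSpace k] {s : k} {f : k⸨X⸩}
    (hf : SummableAt ‖s‖ f) : Summable fun n : ℤ => f.coeff n * s ^ n :=
  hf.summable_norm_coeff_mul_zpow.of_norm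

/-- The sum of a Laurent series. -/
def evalSeries (s : k) (f : k⸨X⸩) : k := ∑' n : ℤ, f.coeff n * s ^ n

theorem evalSeries_mul [CompleteSpace k] {s : k} (hs : s ≠ 0) {f g : k⸨X⸩}
    (hf : SummableAt ‖s‖ f) (hg : SummableAt ‖s‖ g) :
    evalSeries s (f * g) = evalSeries s f * evalSeries s g := by
  have hf' : HasSum (fun n : ℤ => f.coeff n * s ^ n) (evalSeries s f) :=
    hf.summable_coeff_mul_zpow.hasSum
  have hg' : HasSum (fun n : ℤ => g.coeff n * s ^ n) (evalSeries s g) :=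
    hg.summable_coeff_mul_zpow.hasSum
  have h := HasSum.mul hf' hg' (summable_mul_of_summable_norm (f := fun n : ℤ => f.coeff n * s ^ n)
    (g := fun n : ℤ => g.coeff n * s ^ n) hf.summable_norm_coeff_mul_zpow
    hg.summable_norm_coeff_mul_zpow)
  have h' := convolutionEquiv.hasSum_iff.mpr h
  have h'' : HasSum (fun n : ℤ => (f * g).coeff n * s ^ n) (evalSeries s f * evalSeries s g) := by
    refine h'.prod_fiberwise fun n => ?_
    have heq : (fun i : ℤ => f.coeff i * g.coeff (n - i) * s ^ n) = fun i =>
        (f.coeff i * s ^ i) * (g.coeff (n - i) * s ^ (n - i)) := by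
      funext i
      rw [show s ^ n = s ^ i * s ^ (n - i) by rw [← zpow_add₀ hs, add_sub_cancel]]
      ring
    have h1 := (hasSum_coeff_mul f g n).mul_right (s ^ n)
    rw [heq] at h1
    exact h1
  exact h''.tsum_eq

/-- Evaluation of Laurent series at a nonzero point. -/
def evalHom [CompleteSpace k] (s : k) (hs : s ≠ 0) :
    summableSubring k ‖s‖ (norm_pos_iff.mpr hs) →+* k where
  toFun f := evalSeries s f
  map_one' := by
    rw [OneMemClass.coe_one, evalSeries, tsum_eq_single 0]
    · simp
    · intro n hn
      simp [HahnSeries.coeff_one, hn]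
  map_zero' := by simp [evalSeries]
  map_mul' f g := evalSeries_mul hs f.2 g.2
  map_add' f g := by
    rw [evalSeries, evalSeries, evalSeries, ← Summable.tsum_add
      (SummableAt.summable_coeff_mul_zpow f.2) (SummableAt.summable_coeff_mul_zpow g.2)]
    simp [add_mul]

end Evaluation

/-! ### From formal to ordinary unitarity -/

section Specialization

theorem rescaleI_coeff (f : ℝ⸨X⸩) (n : ℤ) :
    (rescaleI f).coeff n = (f.coeff n : ℂ) * Complex.I ^ n := by
  simp [rescaleI, twist, twistFun]

theorem eta_coeff (f : ℂ⸨X⸩) (n : ℤ) : (eta f).coeff n = starRingEnd ℂ (f.coeff n) := by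
  simp [eta, twist, twistFun]

/-- The coefficients are real and (-1)ⁿ iⁿ is the complex conjugate of iⁿ. -/
theorem rescaleI_eps (f : ℝ⸨X⸩) : rescaleI (eps ℝ f) = eta (rescaleI f) := by
  ext n
  rw [rescaleI_coeff, eta_coeff, rescaleI_coeff, eps_coeff, map_mul, Complex.conj_ofReal,
    map_zpow₀, Complex.conj_I, neg_eq_neg_one_mul Complex.I, mul_zpow]
  push_cast
  ring

theorem summableAt_rescaleI {r : ℝ} {f : ℝ⸨X⸩} (hf : SummableAt r f) :
    SummableAt r (rescaleI f) := by
  simpa [SummableAt, rescaleI_coeff] using hf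

theorem evalSeries_eta (s : ℝ) (f : ℂ⸨X⸩) :
    evalSeries (s : ℂ) (eta f) = starRingEnd ℂ (evalSeries (s : ℂ) f) := by
  rw [evalSeries, evalSeries, Complex.conj_tsum]
  simp [eta_coeff]

theorem IsConvergent.eventually_summableAt {k : Type*} [NontriviallyNormedField k] {f : k⸨X⸩}
    (hf : IsConvergent f) : ∀ᶠ r : ℝ in 𝓝[>] 0, SummableAt r f := by
  obtain ⟨r, hr, h⟩ := isConvergent_iff.mp hf
  filter_upwards [Ioo_mem_nhdsGT hr] with s hs using h.mono hs.1 hs.2.le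

theorem rescaleI_mem_unitarySubgroup {N : ℕ} {x : Matrix.GeneralLinearGroup (Fin N) ℝ⸨X⸩}
    (hx : x ∈ unitarySubgroup N (eps ℝ)) :
    Matrix.GeneralLinearGroup.map rescaleI x ∈ unitarySubgroup N eta := by
  rw [mem_unitarySubgroup_iff] at hx ⊢
  intro i j
  change rescaleI ((x⁻¹).val i j) = eta (rescaleI (x.val j i))
  rw [hx, rescaleI_eps]

/-- A radius δ that serves a finite set of monoid generators serves all of G, since the series
summable at |s| form a ring. Evaluation there is a ring homomorphism, and at real s it carries η to
complex conjugation, so x⁻¹ = ᵗη(x) becomes ordinary unitarity. -/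
theorem exists_unitary_specialization {G : Type*} [Group G] [Group.FG G] {N : ℕ}
    (R : G →* Matrix.GeneralLinearGroup (Fin N) ℂ⸨X⸩) (hR : ∀ g, R g ∈ unitarySubgroup N eta)
    (hconv : ∀ g i j, IsConvergent ((R g).val i j)) :
    ∃ δ : ℝ, 0 < δ ∧ ∀ s : ℝ, 0 < |s| → |s| < δ →
      ∃ S : G →* Matrix.unitaryGroup (Fin N) ℂ, ∀ g i j,
        HasSum (fun n : ℤ => ((R g).val i j).coeff n * (s : ℂ) ^ n)
          ((S g : Matrix (Fin N) (Fin N) ℂ) i j) := by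
  obtain ⟨S, hS, hSfin⟩ := (Monoid.fg_iff).mp (Group.fg_iff_monoid_fg.mp ‹Group.FG G›)
  have hev : ∀ᶠ r : ℝ in 𝓝[>] 0, ∀ g ∈ S, ∀ i j, SummableAt r ((R g).val i j) := by
    rw [eventually_all_finite hSfin]
    exact fun g _ => eventually_all.mpr fun i => eventually_all.mpr fun j =>
      (hconv g i j).eventually_summableAt
  obtain ⟨δ, hδ, hδ0⟩ := (hev.and self_mem_nhdsWithin).exists
  refine ⟨δ, hδ0, fun s hs0 hsδ => ?_⟩
  have hs : (s : ℂ) ≠ 0 := by simpa using hs0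
  have hnorm : ‖(s : ℂ)‖ = |s| := by simp
  have hmem : ∀ g i j, (R g).val i j ∈ summableSubring ℂ ‖(s : ℂ)‖ (norm_pos_iff.mpr hs) := by
    refine coefficients_mem_of_closure R _ hS fun g hg i j => ?_
    exact (hδ g hg i j).mono (norm_pos_iff.mpr hs) (hnorm.trans_le hsδ.le)
  obtain ⟨T, hT⟩ := exists_map_coefficients R _ hmem (evalHom (s : ℂ) hs)
  have hTR : ∀ g i j, (T g).val i j = evalSeries (s : ℂ) ((R g).val i j) := hT
  have hU : ∀ g, (T g).val ∈ Matrix.unitaryGroup (Fin N) ℂ := by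
    intro g
    have hstar : star (T g).val = (T g⁻¹).val := by
      ext i j
      rw [Matrix.star_apply, hTR, hTR, map_inv, mem_unitarySubgroup_iff.mp (hR g), evalSeries_eta]
      rfl
    rw [Matrix.mem_unitaryGroup_iff', hstar, ← Units.val_mul, ← map_mul, inv_mul_cancel, map_one,
      Units.val_one]
  refine ⟨((Units.coeHom _).comp T).codRestrict _ hU, fun g i j => ?_⟩
  change HasSum _ ((T g).val i j)
  rw [hTR]
  exact (SummableAt.summable_coeff_mul_zpow (hmem g i j)).hasSum

end Specialization

theorem IsRealOrPadicField.charZero {k : Type*} [NormedField k] (h : IsRealOrPadicField k) :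
    CharZero k := by
  rcases h with ⟨_, _⟩ | ⟨p, _, _, _⟩
  · exact charZero_of_injective_algebraMap (algebraMap ℝ k).injective
  · exact charZero_of_injective_algebraMap (algebraMap ℚ_[p] k).injective

end FormalUnitarity

end

theorem mainTheorem11 :
    -- every finitely generated field between `k(h)` and `k((h))` has a convergent model
    (∀ (k : Type*) [NontriviallyNormedField k], FormalUnitarity.IsRealOrPadicField k →
      ∀ L : IntermediateField k k⸨X⸩, FormalUnitarity.rationalFunctions k ≤ L → L.FG →
      ∀ (t : ℕ) (a : Fin t → L) (m : ℕ),
      ∃ (L' : IntermediateField k k⸨X⸩) (φ : L ≃+* L'),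
        FormalUnitarity.rationalFunctions k ≤ L' ∧
        FormalUnitarity.IsConvergentSubfield L' ∧
        FormalUnitarity.IsOverRationalFunctions φ ∧
        ∀ i, FormalUnitarity.CongrMod m (a i : k⸨X⸩) (φ (a i) : k⸨X⸩)) ∧
    -- the `ε`-equivariant version
    (∀ (k : Type*) [NontriviallyNormedField k], FormalUnitarity.IsRealOrPadicField k →
      ∀ L : IntermediateField k k⸨X⸩, FormalUnitarity.rationalFunctions k ≤ L → L.FG →
      ∀ hL : FormalUnitarity.EpsInvariant L,
      ∀ (t : ℕ) (a : Fin t → L) (m : ℕ),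
      ∃ (L' : IntermediateField k k⸨X⸩) (Ω : L ≃+* L'),
        FormalUnitarity.rationalFunctions k ≤ L' ∧
        FormalUnitarity.EpsInvariant L' ∧
        FormalUnitarity.IsConvergentSubfield L' ∧
        FormalUnitarity.IsOverRationalFunctions Ω ∧
        FormalUnitarity.IsEpsEquivariant hL Ω ∧
        ∀ i, FormalUnitarity.CongrMod m (a i : k⸨X⸩) (Ω (a i) : k⸨X⸩)) ∧
    -- unitary representations by specialization
    (∀ (G : Type*) [Group G] [Group.FG G] (N : ℕ)
      (R : G →* Matrix.GeneralLinearGroup (Fin N) ℝ⸨X⸩),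
      (∀ g, R g ∈ FormalUnitarity.unitarySubgroup N (FormalUnitarity.eps ℝ)) →
      -- the smallest `ε`-invariant field that contains `ℝ(h)` and the coefficients of `R`
      -- exists and is finitely generated
      (∃ L : IntermediateField ℝ ℝ⸨X⸩, L.FG ∧
        IsLeast {M : IntermediateField ℝ ℝ⸨X⸩ |
          FormalUnitarity.rationalFunctions ℝ ≤ M ∧ FormalUnitarity.EpsInvariant M ∧
            ∀ g i j, (R g).val i j ∈ M} L) ∧
      -- every convergent `ε`-equivariant model leads to representations in `U_N`
      ∀ (L L' : IntermediateField ℝ ℝ⸨X⸩) (hL : FormalUnitarity.EpsInvariant L)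
        (hR : ∀ g i j, (R g).val i j ∈ L) (Ω : L ≃+* L'),
        FormalUnitarity.rationalFunctions ℝ ≤ L →
        FormalUnitarity.rationalFunctions ℝ ≤ L' →
        FormalUnitarity.EpsInvariant L' →
        FormalUnitarity.IsConvergentSubfield L' →
        FormalUnitarity.IsEpsEquivariant hL Ω →
        (FormalUnitarity.unitaryOver N L).map
            (Matrix.GeneralLinearGroup.map (Ω : L →+* L')) =
          FormalUnitarity.unitaryOver N L' ∧
        ∃ R' : G →* Matrix.GeneralLinearGroup (Fin N) ℝ⸨X⸩,
          (∀ g i j, (R' g).val i j = (Ω ⟨(R g).val i j, hR g i j⟩ : ℝ⸨X⸩)) ∧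
          (∀ g, R' g ∈ FormalUnitarity.unitarySubgroup N (FormalUnitarity.eps ℝ)) ∧
          (∀ g, Matrix.GeneralLinearGroup.map FormalUnitarity.rescaleI (R' g) ∈
            FormalUnitarity.unitarySubgroup N FormalUnitarity.eta) ∧
          (∀ g i j, FormalUnitarity.IsConvergent
            (FormalUnitarity.rescaleI ((R' g).val i j))) ∧
          ∃ δ : ℝ, 0 < δ ∧ ∀ s : ℝ, 0 < |s| → |s| < δ →
            ∃ S : G →* Matrix.unitaryGroup (Fin N) ℂ, ∀ g i j,
              HasSum (fun n : ℤ =>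
                  (FormalUnitarity.rescaleI ((R' g).val i j)).coeff n * (s : ℂ) ^ n)
                ((S g : Matrix (Fin N) (Fin N) ℂ) i j)) := by
  refine ⟨fun k _ hk L hL hfg t a m => ?_, fun k _ hk L hL hfg hε t a m => ?_,
    fun G _ _ N R hR => ⟨FormalUnitarity.exists_isLeast_epsInvariant R hR, ?_⟩⟩
  · have := hk.charZero
    exact FormalUnitarity.exists_convergent_model L hL hfg t a m
  · have := hk.charZero
    exact FormalUnitarity.exists_equivariant_convergent_model L hL hfg hε t a m
  intro L L' hL hRL Ω _ _ _ hconv hΩ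
  refine ⟨FormalUnitarity.map_unitaryOver hL Ω hΩ, ?_⟩
  -- Ω is defined on L only, so the coefficients are viewed in L, moved to L', and then included in
  -- ℝ((h)).
  obtain ⟨R', hR'⟩ := FormalUnitarity.exists_map_coefficients R L.toSubfield.toSubring hRL
    ((algebraMap L' ℝ⸨X⸩).comp (Ω : L →+* L'))
  have hU : ∀ g, R' g ∈ FormalUnitarity.unitarySubgroup N (FormalUnitarity.eps ℝ) := by
    intro g
    rw [FormalUnitarity.mem_unitarySubgroup_iff]
    intro i j
    rw [← map_inv, hR', hR']
    change (Ω ⟨(R g⁻¹).val i j, hRL g⁻¹ i j⟩ : ℝ⸨X⸩) =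
      FormalUnitarity.eps ℝ (Ω ⟨(R g).val j i, hRL g j i⟩ : ℝ⸨X⸩)
    rw [hΩ]
    congr 3
    rw [map_inv]
    exact FormalUnitarity.mem_unitarySubgroup_iff.mp (hR g) i j
  have hc : ∀ g i j, FormalUnitarity.IsConvergent (FormalUnitarity.rescaleI ((R' g).val i j)) := by
    intro g i j
    have h : FormalUnitarity.IsConvergent ((R' g).val i j) := by
      rw [hR']
      exact hconv _ (Ω ⟨(R g).val i j, hRL g i j⟩).2
    obtain ⟨r, hr, h'⟩ := FormalUnitarity.isConvergent_iff.mp h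
    exact FormalUnitarity.isConvergent_iff.mpr ⟨r, hr, FormalUnitarity.summableAt_rescaleI h'⟩
  exact ⟨R', hR', hU, fun g => FormalUnitarity.rescaleI_mem_unitarySubgroup (hU g), hc,
    FormalUnitarity.exists_unitary_specialization
      ((Matrix.GeneralLinearGroup.map FormalUnitarity.rescaleI).comp R')
      (fun g => FormalUnitarity.rescaleI_mem_unitarySubgroup (hU g)) hc⟩
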